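/- \textbf{Definitions.} A \emph{contact relation} on a Boolean algebra $B$ (where $0=1$ is allowed) is a binary relation $\rho$ such that: $a\rho a$ for $a\neq 0$; $a\rho b$ implies $a\ne 0\neq b$; $a\rho b$ implies $b\rho a$; $a\rho(b\vee c)$ iff $a\rho b$ or $a\rho c$. Write $a\ll_\rho b$ iff not $a\rho b^*$. A \emph{complete local contact algebra} $(B,\rho,\mathbb B)$ is a complete Boolean algebra $B$ with a contact relation $\rho$ and a subset $\mathbb B\subseteq B$ of \emph{bounded} elements, containing $0$, downward closed and closed under binary joins, such that: (BC1) if $a\in\mathbb B$ and $a\ll_\rho c$ then $a\ll_\rho b\ll_\rho c$ for some $b\in\mathbb B$; (BC2) if $a\rho b$ then $a\rho(c\wedge b)$ for some $c\in\mathbb B$; (BC3) if $a\ne0$ then $b\ll_\rho a$ for some $b\in\mathbb B\setminus\{0\}$. A \emph{complete MVD-algebra} $(B,\le,\ll)$ is a complete Boolean algebra with a binary relation $\ll$ such that: $a\ll b$ implies $a\le b$; $0\ll0$; $a\le b\ll c\le t$ implies $a\ll t$; $a\ll c$ and $b\ll c$ imply $a\vee b\ll c$; $a\ll c$ implies $a\ll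 b\ll c$ for some $b$; if $a\neq0$ then $b\ll a$ for some $b\ne0$; $a\ll b$ and $a\ll c$ imply $a\ll b\wedge c$; $a\ll1$ and $b^*\ll a^*$ imply $a\ll b$. For a complete Boolean homomorphism $\varphi:A\to B$ (preserving all joins, all meets and complements) let $\varphi_\Lambda:B\to A$ be its lower adjoint: $\varphi_\Lambda(b)\le a$ iff $b\le\varphi(a)$. The objects of $\mathbf{ISKAL}$ are the complete local contact algebras; its morphisms $(A,\rho,\mathbb B)\to(B,\eta,\mathbb B')$ are the complete Boolean homomorphisms $\varphi:A\to B$ such that (L1) $\varphi(a)\eta\varphi(b)$ implies $a\rho b$; (L2) $b\in\mathbb B'$ implies $\varphi_\Lambda(b)\in\mathbb B$; (IS) for every ultrafilter $u$ of $A$ meeting $\mathbb B$ there is an ultrafilter $v$ of $B$ meeting $\mathbb B'$ such that $\varphi_\Lambda(b)\,\rho\,a$ for all $b\in v$, $a\in u$. The objects of $\mathbf{IISKAL}$ are the complete MVD-algebras; its morphisms $(B,\le,\ll)\to(B',\le',\ll')$ are the complete Boolean homomorphisms $\varphi:B\to B'$ such that (S1) for all $a,b\in B$, if $c\wedge a\ll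 c^*\vee b$ for all $c\in B$ with $c\ll1$, then $d\wedge\varphi(a)\ll' d^*\vee\varphi(b)$ for all $d\in B'$ with $d\ll'1$; (S2) for $b\in B'$, $b\ll'1$ implies $\varphi_\Lambda(b)\ll1$; (IS$'$) for every ultrafilter $u$ of $B$ containing some $c\ll1$ there is an ultrafilter $v$ of $B'$ containing some $c'\ll'1$ such that for all $a\in u$, $b\in v$ there is $c''\in B$ with $c''\ll1$ and $\varphi_\Lambda(b)\wedge c''\not\ll(a\wedge c'')^*$. The objects of $\mathbf{SSKLC}$ are the locally compact Hausdorff spaces; its morphisms are the surjective continuous maps $f:X\to Y$ that are skeletal, i.e. $\operatorname{int}(\operatorname{cl}(f(U)))\ne\emptyset$ for every non-empty open $U\subseteq X$. Composition in all three categories is the usual composition of maps. \textbf{Theorem.} The categories $\mathbf{ISKAL}$ and $\mathbf{IISKAL}$ are isomorphic; hence the categories $\mathbf{SSKLC}$ and $\mathbf{IISKAL}$ are dually equivalent. -/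

import Mathlib

universe u

namespace LCDuality

open CategoryTheory

/-! ## Boolean preliminaries -/

section Boolean

variable {A B C : Type*}

/-- The lower adjoint `φ_Λ` of a complete homomorphism `φ : A → B`, i.e. the order-preserving map
with `φ_Λ b ≤ a ↔ b ≤ φ a` (see `lowerAdj_gc`). -/
def lowerAdj [CompleteLattice A] [CompleteLattice B] (φ : CompleteLatticeHom A B) (b : B) : A :=
  sInf {a | b ≤ φ a}

theorem lowerAdj_gc [CompleteLattice A] [CompleteLattice B] (φ : CompleteLatticeHom A B) :
    GaloisConnection (lowerAdj φ) φ := by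
  intro b a
  constructor
  · intro h
    have h1 : b ≤ φ (lowerAdj φ b) := by
      unfold lowerAdj
      rw [map_sInf]
      apply le_sInf
      rintro _ ⟨x, hx, rfl⟩
      exact hx
    exact h1.trans (OrderHomClass.mono φ h)
  · intro h
    exact sInf_le h

theorem lowerAdj_id [CompleteLattice A] (a : A) :
    lowerAdj (CompleteLatticeHom.id A) a = a :=
  (lowerAdj_gc (CompleteLatticeHom.id A)).l_unique GaloisConnection.id (fun _ => rfl)

theorem lowerAdj_comp [CompleteLattice A] [CompleteLattice B] [CompleteLattice C]
    (ψ : CompleteLatticeHom B C) (φ : CompleteLatticeHom A B) (c : C) :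
    lowerAdj (ψ.comp φ) c = lowerAdj φ (lowerAdj ψ c) :=
  (lowerAdj_gc (ψ.comp φ)).l_unique ((lowerAdj_gc ψ).compose (lowerAdj_gc φ)) (fun _ => rfl)

/-- `U` is an ultrafilter of the Boolean algebra `A`: a proper filter which contains, for every
element, that element or its complement. -/
structure IsUltrafilter [BooleanAlgebra A] (U : Set A) : Prop where
  top_mem : ⊤ ∈ U
  bot_notMem : ⊥ ∉ U
  mem_of_le : ∀ a b, a ≤ b → a ∈ U → b ∈ U
  inf_mem : ∀ a b, a ∈ U → b ∈ U → a ⊓ b ∈ U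
  mem_or_compl_mem : ∀ a, a ∈ U ∨ aᶜ ∈ U

end Boolean

/-! ## Local contact algebras -/

/-- Axioms of a contact relation on a Boolean algebra. -/
structure IsContact {B : Type*} [BooleanAlgebra B] (ρ : B → B → Prop) : Prop where
  C1 : ∀ a, a ≠ ⊥ → ρ a a
  C2 : ∀ a b, ρ a b → a ≠ ⊥ ∧ b ≠ ⊥
  C3 : ∀ a b, ρ a b → ρ b a
  C4 : ∀ a b c, ρ a (b ⊔ c) ↔ ρ a b ∨ ρ a c

/-- Non-tangential inclusion `a ≪_ρ b`: the elements `a` and `b*` are not in contact. -/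
def NonTang {B : Type*} [BooleanAlgebra B] (ρ : B → B → Prop) (a b : B) : Prop :=
  ¬ ρ a bᶜ

/-- `(B, ρ, 𝔹)` is a local contact algebra. -/
structure IsLCA {B : Type*} [BooleanAlgebra B] (ρ : B → B → Prop) (bdd : Set B) : Prop
    extends IsContact ρ where
  BB1 : ⊥ ∈ bdd
  BB2 : ∀ a b, a ≤ b → b ∈ bdd → a ∈ bdd
  BB3 : ∀ a b, a ∈ bdd → b ∈ bdd → a ⊔ b ∈ bdd
  BC1 : ∀ a c, a ∈ bdd → NonTang ρ a c → ∃ b ∈ bdd, NonTang ρ a b ∧ NonTang ρ b c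
  BC2 : ∀ a b, ρ a b → ∃ c ∈ bdd, ρ a (c ⊓ b)
  BC3 : ∀ a, a ≠ ⊥ → ∃ b ∈ bdd, b ≠ ⊥ ∧ NonTang ρ b a

/-- The category of complete local contact algebras and SKAL-morphisms satisfying (IS); this
structure is its class of objects. -/
structure ISKAL : Type (u + 1) where
  carrier : Type u
  [str : CompleteBooleanAlgebra carrier]
  contact : carrier → carrier → Prop
  bounded : Set carrier
  isLCA : IsLCA contact bounded

attribute [instance] ISKAL.str

/-- SKAL-morphisms between complete local contact algebras. -/
structure IsSKALMorphism {A B : ISKAL.{u}} (φ : CompleteLatticeHom A.carrier B.carrier) :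
    Prop where
  L1 : ∀ a b, B.contact (φ a) (φ b) → A.contact a b
  L2 : ∀ b ∈ B.bounded, lowerAdj φ b ∈ A.bounded

/-- A bounded ultrafilter: an ultrafilter containing a bounded element. -/
def IsBoundedUltrafilter (A : ISKAL.{u}) (U : Set A.carrier) : Prop :=
  IsUltrafilter U ∧ (U ∩ A.bounded).Nonempty

/-- SKAL-morphisms satisfying condition (IS). -/
structure IsISKALMorphism {A B : ISKAL.{u}} (φ : CompleteLatticeHom A.carrier B.carrier) : Prop
    extends IsSKALMorphism φ where
  IS : ∀ U : Set A.carrier, IsBoundedUltrafilter A U →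
    ∃ V : Set B.carrier, IsBoundedUltrafilter B V ∧
      ∀ x ∈ lowerAdj φ '' V, ∀ a ∈ U, A.contact x a

theorem IsContact.mono {B : Type*} [BooleanAlgebra B] {ρ : B → B → Prop} (h : IsContact ρ)
    {a b c d : B} (hab : a ≤ b) (hcd : c ≤ d) (hac : ρ a c) : ρ b d := by
  have h1 : ρ a d := by
    have := (h.C4 a c d).2 (Or.inl hac)
    rwa [sup_eq_right.2 hcd] at this
  have h2 := (h.C4 d a b).2 (Or.inl (h.C3 _ _ h1))
  rw [sup_eq_right.2 hab] at h2
  exact h.C3 _ _ h2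

theorem isISKALMorphism_id (A : ISKAL.{u}) :
    IsISKALMorphism (A := A) (B := A) (CompleteLatticeHom.id A.carrier) where
  L1 _ _ h := h
  L2 b hb := by rwa [lowerAdj_id]
  IS U hU := by
    refine ⟨U, hU, ?_⟩
    rintro _ ⟨b, hb, rfl⟩ a ha
    rw [lowerAdj_id]
    have hab := hU.1.inf_mem _ _ hb ha
    have hne : b ⊓ a ≠ ⊥ := fun h => hU.1.bot_notMem (h ▸ hab)
    exact A.isLCA.toIsContact.mono inf_le_left inf_le_right (A.isLCA.C1 _ hne)

theorem isISKALMorphism_comp {A B C : ISKAL.{u}}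
    {φ : CompleteLatticeHom A.carrier B.carrier} {ψ : CompleteLatticeHom B.carrier C.carrier}
    (hφ : IsISKALMorphism φ) (hψ : IsISKALMorphism ψ) :
    IsISKALMorphism (A := A) (B := C) (ψ.comp φ) where
  L1 a b h := hφ.L1 a b (hψ.L1 _ _ h)
  L2 c hc := by
    rw [lowerAdj_comp]
    exact hφ.L2 _ (hψ.L2 _ hc)
  IS U hU := by
    obtain ⟨V, hV, hVU⟩ := hφ.IS U hU
    obtain ⟨W, hW, hWV⟩ := hψ.IS V hV
    refine ⟨W, hW, ?_⟩
    rintro _ ⟨c, hc, rfl⟩ a ha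
    rw [lowerAdj_comp]
    by_contra hcon
    obtain ⟨c', hc'W, hc'b⟩ := hW.2
    set c₀ := c ⊓ c' with hc₀
    have hc₀W : c₀ ∈ W := hW.1.inf_mem _ _ hc hc'W
    set e := lowerAdj ψ c₀ with he
    set d := lowerAdj φ e with hd
    have hdb : d ∈ A.bounded :=
      hφ.L2 _ (hψ.L2 _ (C.isLCA.BB2 _ _ inf_le_right hc'b))
    have hdle : d ≤ lowerAdj φ (lowerAdj ψ c) :=
      (lowerAdj_gc φ).monotone_l ((lowerAdj_gc ψ).monotone_l inf_le_left)
    have hda : NonTang A.contact d aᶜ := fun h => by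
      rw [compl_compl] at h
      exact hcon (A.isLCA.toIsContact.mono hdle le_rfl h)
    obtain ⟨d₁, -, hd₁, hd₁a⟩ := A.isLCA.BC1 _ _ hdb hda
    have hV₁ : φ d₁ ∈ V := by
      refine (hV.1.mem_or_compl_mem (φ d₁)).resolve_right fun hn => ?_
      have h1 : B.contact e (φ d₁)ᶜ := hWV _ ⟨c₀, hc₀W, rfl⟩ _ hn
      have h2 : B.contact (φ d) (φ d₁ᶜ) := by
        rw [map_compl']
        exact B.isLCA.toIsContact.mono ((lowerAdj_gc φ).le_u_l e) le_rfl h1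
      exact hd₁ (hφ.L1 _ _ h2)
    have h3 := hVU _ ⟨_, hV₁, rfl⟩ a ha
    apply hd₁a
    rw [compl_compl]
    exact A.isLCA.toIsContact.mono ((lowerAdj_gc φ).l_u_le d₁) le_rfl h3

/-- Morphisms of the category `ISKAL`. -/
@[ext]
structure ISKAL.Hom (A B : ISKAL.{u}) : Type u where
  hom : CompleteLatticeHom A.carrier B.carrier
  isMorphism : IsISKALMorphism hom

instance : Category ISKAL.{u} where
  Hom A B := ISKAL.Hom A B
  id A := ⟨CompleteLatticeHom.id A.carrier, isISKALMorphism_id A⟩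
  comp f g := ⟨g.hom.comp f.hom, isISKALMorphism_comp f.isMorphism g.isMorphism⟩

/-! ## MVD-algebras -/

/-- `(B, ≤, ≪)` is an MVD-algebra. -/
structure IsMVD {B : Type*} [BooleanAlgebra B] (ll : B → B → Prop) : Prop where
  ll1 : ∀ a b, ll a b → a ≤ b
  ll2 : ll ⊥ ⊥
  ll3 : ∀ a b c t, a ≤ b → ll b c → c ≤ t → ll a t
  ll4 : ∀ a b c, ll a c → ll b c → ll (a ⊔ b) c
  ll5 : ∀ a c, ll a c → ∃ b, ll a b ∧ ll b c
  ll6 : ∀ a, a ≠ ⊥ → ∃ b, b ≠ ⊥ ∧ ll b a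
  ll4_star : ∀ a b c, ll a b → ll a c → ll a (b ⊓ c)
  mvd : ∀ a b, ll a ⊤ → ll bᶜ aᶜ → ll a b

/-- The category of complete MVD-algebras and IKA-morphisms satisfying (IS'); this structure is
its class of objects. -/
structure IISKAL : Type (u + 1) where
  carrier : Type u
  [str : CompleteBooleanAlgebra carrier]
  ll : carrier → carrier → Prop
  isMVD : IsMVD ll

attribute [instance] IISKAL.str

/-- IKA-morphisms between complete MVD-algebras. -/
structure IsIKAMorphism {A B : IISKAL.{u}} (φ : CompleteLatticeHom A.carrier B.carrier) :
    Prop where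
  S1 : ∀ a b, (∀ c, A.ll c ⊤ → A.ll (c ⊓ a) (cᶜ ⊔ b)) →
    ∀ d, B.ll d ⊤ → B.ll (d ⊓ φ a) (dᶜ ⊔ φ b)
  S2 : ∀ b, B.ll b ⊤ → A.ll (lowerAdj φ b) ⊤

/-- IKA-morphisms satisfying condition (IS'). -/
structure IsIISKALMorphism {A B : IISKAL.{u}} (φ : CompleteLatticeHom A.carrier B.carrier) : Prop
    extends IsIKAMorphism φ where
  IS' : ∀ U : Set A.carrier, IsUltrafilter U → (∃ c ∈ U, A.ll c ⊤) →
    ∃ V : Set B.carrier, IsUltrafilter V ∧ (∃ c' ∈ V, B.ll c' ⊤) ∧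
      ∀ a ∈ U, ∀ b ∈ V, ∃ c'' : A.carrier, A.ll c'' ⊤ ∧
        ¬ A.ll (lowerAdj φ b ⊓ c'') (a ⊓ c'')ᶜ

theorem isIISKALMorphism_id (A : IISKAL.{u}) :
    IsIISKALMorphism (A := A) (B := A) (CompleteLatticeHom.id A.carrier) where
  S1 _ _ h := h
  S2 b hb := by rwa [lowerAdj_id]
  IS' U hU hb := by
    refine ⟨U, hU, hb, ?_⟩
    intro a ha b hbU
    obtain ⟨c, hc, hct⟩ := hb
    refine ⟨c, hct, fun h => ?_⟩
    rw [lowerAdj_id] at h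
    have h1 := A.isMVD.ll1 _ _ h
    have h2 : (b ⊓ c) ⊓ (a ⊓ c) = ⊥ := disjoint_iff.1 (le_compl_iff_disjoint_right.1 h1)
    exact hU.bot_notMem (h2 ▸ hU.inf_mem _ _ (hU.inf_mem _ _ hbU hc) (hU.inf_mem _ _ ha hc))

theorem isIISKALMorphism_comp {A B C : IISKAL.{u}}
    {φ : CompleteLatticeHom A.carrier B.carrier} {ψ : CompleteLatticeHom B.carrier C.carrier}
    (hφ : IsIISKALMorphism φ) (hψ : IsIISKALMorphism ψ) :
    IsIISKALMorphism (A := A) (B := C) (ψ.comp φ) where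
  S1 a b h := hψ.S1 _ _ (hφ.S1 a b h)
  S2 c hc := by
    rw [lowerAdj_comp]
    exact hφ.S2 _ (hψ.S2 _ hc)
  IS' U hU hUb := by
    obtain ⟨V, hV, hVb, hVU⟩ := hφ.IS' U hU hUb
    obtain ⟨W, hW, hWb, hWV⟩ := hψ.IS' V hV hVb
    refine ⟨W, hW, hWb, ?_⟩
    intro a ha c hc
    rw [lowerAdj_comp]
    by_contra! hcon
    obtain ⟨c', hc'W, hc'b⟩ := hWb
    set c₀ := c ⊓ c' with hc₀
    have hc₀W : c₀ ∈ W := hW.inf_mem _ _ hc hc'W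
    set e := lowerAdj ψ c₀ with he
    set d := lowerAdj φ e with hd
    have hdb : A.ll d ⊤ :=
      hφ.S2 _ (hψ.S2 _ (C.isMVD.ll3 _ _ _ _ inf_le_right hc'b le_rfl))
    have hdle : d ≤ lowerAdj φ (lowerAdj ψ c) :=
      (lowerAdj_gc φ).monotone_l ((lowerAdj_gc ψ).monotone_l inf_le_left)
    have hda : A.ll d aᶜ := by
      obtain ⟨g, hdg, hg⟩ := A.isMVD.ll5 _ _ hdb
      have h1 := hcon g hg
      have h2 : A.ll d (a ⊓ g)ᶜ :=
        A.isMVD.ll3 _ _ _ _ (le_inf hdle (A.isMVD.ll1 _ _ hdg)) h1 le_rfl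
      refine A.isMVD.ll3 _ _ _ _ le_rfl (A.isMVD.ll4_star _ _ _ hdg h2) ?_
      rw [compl_inf, inf_sup_left, inf_compl_eq_bot, sup_bot_eq]
      exact inf_le_right
    obtain ⟨d₁, hd₁, hd₁a⟩ := A.isMVD.ll5 _ _ hda
    have hV₁ : φ d₁ ∈ V := by
      refine (hV.mem_or_compl_mem (φ d₁)).resolve_right fun hn => ?_
      obtain ⟨f, hf, hnf⟩ := hWV _ hn c₀ hc₀W
      apply hnf
      have h1 := hφ.S1 d d₁
        (fun g _ => A.isMVD.ll3 _ _ _ _ inf_le_right hd₁ le_sup_right) f hf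
      refine B.isMVD.ll3 _ _ _ _ ?_ h1 ?_
      · exact le_inf inf_le_right (inf_le_left.trans ((lowerAdj_gc φ).le_u_l e))
      · rw [compl_inf, compl_compl, sup_comm]
    obtain ⟨g, _, hng⟩ := hVU a ha _ hV₁
    apply hng
    refine A.isMVD.ll3 _ _ _ _ ?_ hd₁a (compl_le_compl inf_le_left)
    exact inf_le_left.trans ((lowerAdj_gc φ).l_u_le d₁)

/-- Morphisms of the category `IISKAL`. -/
@[ext]
structure IISKAL.Hom (A B : IISKAL.{u}) : Type u where
  hom : CompleteLatticeHom A.carrier B.carrier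
  isMorphism : IsIISKALMorphism hom

instance : Category IISKAL.{u} where
  Hom A B := IISKAL.Hom A B
  id A := ⟨CompleteLatticeHom.id A.carrier, isIISKALMorphism_id A⟩
  comp f g := ⟨g.hom.comp f.hom, isIISKALMorphism_comp f.isMorphism g.isMorphism⟩

/-! ## Spaces -/

/-- A map is skeletal if the closure of the image of every nonempty open set has nonempty
interior. -/
def IsSkeletal {X Y : Type*} [TopologicalSpace X] [TopologicalSpace Y] (f : X → Y) : Prop :=
  ∀ U : Set X, IsOpen U → U.Nonempty → (interior (closure (f '' U))).Nonempty

/-- The category of locally compact Hausdorff spaces and surjective continuous skeletal maps; this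
structure is its class of objects. -/
structure SSKLC : Type (u + 1) where
  carrier : Type u
  [top : TopologicalSpace carrier]
  [locallyCompact : LocallyCompactSpace carrier]
  [t2 : T2Space carrier]

attribute [instance] SSKLC.top SSKLC.locallyCompact SSKLC.t2

/-- Morphisms of the category `SSKLC`. -/
@[ext]
structure SSKLC.Hom (X Y : SSKLC.{u}) : Type u where
  toFun : X.carrier → Y.carrier
  continuous : Continuous toFun
  skeletal : IsSkeletal toFun
  surjective : Function.Surjective toFun

theorem isSkeletal_id (X : Type*) [TopologicalSpace X] : IsSkeletal (id : X → X) := by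
  intro U hU hne
  rw [Set.image_id]
  exact hne.mono (interior_maximal subset_closure hU)

theorem IsSkeletal.comp {X Y Z : Type*} [TopologicalSpace X] [TopologicalSpace Y]
    [TopologicalSpace Z] {g : Y → Z} {f : X → Y} (hg : IsSkeletal g) (hgc : Continuous g)
    (hf : IsSkeletal f) : IsSkeletal (g ∘ f) := by
  intro U hU hne
  refine (hg _ isOpen_interior (hf U hU hne)).mono (interior_mono ?_)
  refine closure_minimal ?_ isClosed_closure
  rw [Set.image_comp]
  exact (Set.image_mono interior_subset).trans (image_closure_subset_closure_image hgc)

instance : Category SSKLC.{u} where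
  Hom X Y := SSKLC.Hom X Y
  id X := ⟨id, continuous_id, isSkeletal_id _, Function.surjective_id⟩
  comp f g := ⟨g.toFun ∘ f.toFun, g.continuous.comp f.continuous,
    g.skeletal.comp g.continuous f.skeletal, g.surjective.comp f.surjective⟩

end LCDuality

open CategoryTheory LCDuality

namespace LCDuality

open CategoryTheory TopologicalSpace Set

/-! ## Non-tangential inclusion -/

section NonTang

variable {B : Type*} [BooleanAlgebra B] {ρ : B → B → Prop} {a b c d : B}

/-! On a fixed complete Boolean algebra the two structures determine each other. From a local
contact algebra, let a ≪ b mean that a is bounded and not in contact with b*. From an MVD-relation,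
call a bounded if a ≪ 1, and let a and b be in contact if c ∧ a ≪ (c ∧ b)* fails for some bounded c.
These passages are mutually inverse (`llContact_boundedNonTang`, `boundedNonTang_llContact`), and
the conditions on a homomorphism match one by one: (L1) with (S1), (L2) with (S2), (IS) with (IS').
Hence both functors leave underlying homomorphisms unchanged.

For the duality it remains to treat `ISKAL`. A space goes to its regular open sets, in contact when
their closures meet and bounded when the closure is compact; a map f goes to U ↦ int cl f⁻¹(U). This
is a complete homomorphism because preimages of dense open sets under skeletal maps are dense
(`IsSkeletal.dense_preimage`). The functor is faithful because spaces are Hausdorff. It is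
essentially surjective because a complete local contact algebra is the regular open algebra of its
space of round prime filters (`exists_of_contact`, `isCompact_closure_basic`,
`basicRegular_surjective`). It is full because (L1) and (L2) let a homomorphism transport points
backwards to a point map f, the lower adjoint shows f skeletal, and (IS) makes f surjective. -/

theorem IsContact.symm_iff (h : IsContact ρ) : ρ a b ↔ ρ b a :=
  ⟨h.C3 a b, h.C3 b a⟩

theorem IsContact.of_inf_ne_bot (h : IsContact ρ) (hab : a ⊓ b ≠ ⊥) : ρ a b :=
  h.mono inf_le_left inf_le_right (h.C1 _ hab)

theorem NonTang.le (hρ : IsContact ρ) (h : NonTang ρ a b) : a ≤ b := by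
  by_contra hab
  refine h (hρ.of_inf_ne_bot fun h0 => hab ?_)
  simpa using le_compl_iff_disjoint_right.2 (disjoint_iff.2 h0)

theorem NonTang.mono (hρ : IsContact ρ) (h : NonTang ρ b c) (hab : a ≤ b) (hcd : c ≤ d) :
    NonTang ρ a d :=
  fun h' => h (hρ.mono hab (compl_le_compl hcd) h')

theorem NonTang.compl (hρ : IsContact ρ) (h : NonTang ρ a b) : NonTang ρ bᶜ aᶜ := by
  intro h'
  rw [compl_compl] at h'
  exact h (hρ.C3 _ _ h')

theorem NonTang.sup (hρ : IsContact ρ) (h₁ : NonTang ρ a c) (h₂ : NonTang ρ b c) :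
    NonTang ρ (a ⊔ b) c := by
  intro h
  rw [hρ.symm_iff, hρ.C4, hρ.symm_iff, hρ.symm_iff (b := b)] at h
  exact h.elim h₁ h₂

theorem NonTang.inf (hρ : IsContact ρ) (h₁ : NonTang ρ a b) (h₂ : NonTang ρ a c) :
    NonTang ρ a (b ⊓ c) := by
  intro h
  rw [compl_inf, hρ.C4] at h
  exact h.elim h₁ h₂

theorem NonTang.top (hρ : IsContact ρ) : NonTang ρ a ⊤ :=
  fun h => (hρ.C2 _ _ h).2 compl_top

theorem NonTang.bot (hρ : IsContact ρ) : NonTang ρ ⊥ a :=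
  fun h => (hρ.C2 _ _ h).1 rfl

end NonTang

/-! ## The isomorphism between `ISKAL` and `IISKAL` -/

/-- The MVD-relation of a local contact algebra. -/
def boundedNonTang {B : Type*} [BooleanAlgebra B] (ρ : B → B → Prop) (bdd : Set B) (a b : B) :
    Prop :=
  a ∈ bdd ∧ NonTang ρ a b

theorem boundedNonTang_top {B : Type*} [BooleanAlgebra B] {ρ : B → B → Prop} {bdd : Set B}
    (h : IsLCA ρ bdd) (a : B) : boundedNonTang ρ bdd a ⊤ ↔ a ∈ bdd :=
  and_iff_left (NonTang.top h.toIsContact)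

theorem IsLCA.isMVD {B : Type*} [BooleanAlgebra B] {ρ : B → B → Prop} {bdd : Set B}
    (h : IsLCA ρ bdd) : IsMVD (boundedNonTang ρ bdd) where
  ll1 _ _ hab := hab.2.le h.toIsContact
  ll2 := ⟨h.BB1, NonTang.bot h.toIsContact⟩
  ll3 _ _ _ _ hab hbc hct := ⟨h.BB2 _ _ hab hbc.1, hbc.2.mono h.toIsContact hab hct⟩
  ll4 _ _ _ hac hbc := ⟨h.BB3 _ _ hac.1 hbc.1, hac.2.sup h.toIsContact hbc.2⟩
  ll5 a c hac := by
    obtain ⟨b, hb, hab, hbc⟩ := h.BC1 a c hac.1 hac.2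
    exact ⟨b, ⟨hac.1, hab⟩, hb, hbc⟩
  ll6 a ha := by
    obtain ⟨b, hb, hb0, hba⟩ := h.BC3 a ha
    exact ⟨b, hb0, hb, hba⟩
  ll4_star _ _ _ hab hac := ⟨hab.1, hab.2.inf h.toIsContact hac.2⟩
  mvd a b ha hab := by
    refine ⟨ha.1, ?_⟩
    simpa using hab.2.compl h.toIsContact

/-- The contact relation of an MVD-algebra. -/
def llContact {B : Type*} [BooleanAlgebra B] (ll : B → B → Prop) (a b : B) : Prop :=
  ∃ c, ll c ⊤ ∧ ¬ ll (c ⊓ a) (c ⊓ b)ᶜ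

section MVD

variable {B : Type*} [BooleanAlgebra B] {ll : B → B → Prop} {a b c : B}

theorem IsMVD.ll_compl_symm (h : IsMVD ll) (hb : ll b ⊤) (hab : ll a bᶜ) : ll b aᶜ :=
  h.mvd _ _ hb (by simpa using hab)

theorem nonTang_llContact : NonTang (llContact ll) a b ↔
    ∀ c, ll c ⊤ → ll (c ⊓ a) (cᶜ ⊔ b) := by
  simp [NonTang, llContact, compl_inf]

theorem IsMVD.nonTang_of_ll (h : IsMVD ll) (hab : ll a b) : NonTang (llContact ll) a b :=
  nonTang_llContact.2 fun _ _ => h.ll3 _ _ _ _ inf_le_right hab le_sup_right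

/-- Interpolating a ≪ c ≪ 1 gives a bounded c with c ∧ a = a. The hypothesis at this c reads a ≪ c*
∨ b, and combining it with a ≪ c gives a ≪ c ∧ b. -/
theorem IsMVD.ll_of_nonTang (h : IsMVD ll) (ha : ll a ⊤) (hab : NonTang (llContact ll) a b) :
    ll a b := by
  obtain ⟨c, hac, hc⟩ := h.ll5 _ _ ha
  have h1 := nonTang_llContact.1 hab c hc
  rw [inf_eq_right.2 (h.ll1 _ _ hac)] at h1
  refine h.ll3 _ _ _ _ le_rfl (h.ll4_star _ _ _ hac h1) ?_
  rw [inf_sup_left, inf_compl_eq_bot, bot_sup_eq]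
  exact inf_le_right

theorem IsMVD.ll_iff (h : IsMVD ll) : ll a b ↔ ll a ⊤ ∧ NonTang (llContact ll) a b :=
  ⟨fun hab => ⟨h.ll3 _ _ _ _ le_rfl hab le_top, h.nonTang_of_ll hab⟩,
    fun hab => h.ll_of_nonTang hab.1 hab.2⟩

theorem IsMVD.isLCA (h : IsMVD ll) : IsLCA (llContact ll) {a | ll a ⊤} := by
  have C3 : ∀ a b, llContact ll a b → llContact ll b a := by
    rintro a b ⟨c, hc, hab⟩
    exact ⟨c, hc, fun hba => hab (h.ll_compl_symm (h.ll3 _ _ _ _ inf_le_left hc le_rfl) hba)⟩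
  have bot_ll : ∀ a, ll ⊥ a := fun a => h.ll3 _ _ _ _ le_rfl h.ll2 bot_le
  have C2 : ∀ a b, llContact ll a b → a ≠ ⊥ := by
    rintro a b ⟨c, hc, hab⟩ rfl
    exact hab (by simpa using bot_ll _)
  have C1 : ∀ a, a ≠ ⊥ → llContact ll a a := by
    intro a ha
    obtain ⟨b, hb0, hba⟩ := h.ll6 a ha
    refine ⟨b, h.ll3 _ _ _ _ le_rfl hba le_top, fun hb => hb0 ?_⟩
    have h1 := h.ll1 _ _ hb
    rw [inf_eq_left.2 (h.ll1 _ _ hba)] at h1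
    exact le_compl_self.1 h1
  have C4 : ∀ a b c, llContact ll a (b ⊔ c) ↔ llContact ll a b ∨ llContact ll a c := by
    intro a b c
    constructor
    · rintro ⟨d, hd, hn⟩
      by_contra! hcon
      simp only [llContact, not_exists, not_and, not_not] at hcon
      apply hn
      rw [inf_sup_left, compl_sup]
      exact h.ll4_star _ _ _ (hcon.1 d hd) (hcon.2 d hd)
    · rintro (⟨d, hd, hn⟩ | ⟨d, hd, hn⟩)
      · exact ⟨d, hd, fun h' => hn (h.ll3 _ _ _ _ le_rfl h'
          (compl_le_compl (inf_le_inf_left d le_sup_left)))⟩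
      · exact ⟨d, hd, fun h' => hn (h.ll3 _ _ _ _ le_rfl h'
          (compl_le_compl (inf_le_inf_left d le_sup_right)))⟩
  refine
    { C1 := C1
      C2 := fun a b hab => ⟨C2 a b hab, C2 b a (C3 a b hab)⟩
      C3 := C3
      C4 := C4
      BB1 := bot_ll _
      BB2 := fun a b hab hb => h.ll3 _ _ _ _ hab hb le_rfl
      BB3 := fun a b ha hb => h.ll4 _ _ _ ha hb
      BC1 := fun a c ha hac => ?_
      BC2 := ?_
      BC3 := fun a ha => ?_ }
  · obtain ⟨b, hab, hbc⟩ := h.ll5 _ _ (h.ll_of_nonTang ha hac)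
    exact ⟨b, h.ll3 _ _ _ _ le_rfl hbc le_top, h.nonTang_of_ll hab, h.nonTang_of_ll hbc⟩
  · rintro a b ⟨c, hc, hab⟩
    refine ⟨c, hc, c, hc, ?_⟩
    rwa [inf_left_idem]
  · obtain ⟨b, hb0, hba⟩ := h.ll6 a ha
    exact ⟨b, h.ll3 _ _ _ _ le_rfl hba le_top, hb0, h.nonTang_of_ll hba⟩

theorem llContact_boundedNonTang {ρ : B → B → Prop} {bdd : Set B} (h : IsLCA ρ bdd) :
    llContact (boundedNonTang ρ bdd) = ρ := by
  have hρ := h.toIsContact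
  funext a b
  simp only [llContact, boundedNonTang_top h]
  simp only [boundedNonTang, NonTang, compl_compl, not_and, not_not]
  refine propext ⟨?_, fun hab => ?_⟩
  · rintro ⟨c, hc, h'⟩
    exact hρ.mono inf_le_right inf_le_right (h' (h.BB2 _ _ inf_le_left hc))
  -- (BC2) in each argument in turn puts c ∧ b in contact with d ∧ a; the bounded element c ∨ d
  -- dominates both cuts.
  · obtain ⟨c, hc, h1⟩ := h.BC2 _ _ hab
    obtain ⟨d, hd, h2⟩ := h.BC2 _ _ (hρ.C3 _ _ h1)
    exact ⟨c ⊔ d, h.BB3 _ _ hc hd, fun _ => hρ.C3 _ _ <| hρ.mono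
      (inf_le_inf_right _ le_sup_left) (inf_le_inf_right _ le_sup_right) h2⟩

theorem boundedNonTang_llContact (h : IsMVD ll) :
    boundedNonTang (llContact ll) {a | ll a ⊤} = ll := by
  funext a b
  exact propext h.ll_iff.symm

end MVD

/-- The complete MVD-algebra of a complete local contact algebra. -/
abbrev ISKAL.toIISKAL (A : ISKAL.{u}) : IISKAL.{u} where
  carrier := A.carrier
  ll := boundedNonTang A.contact A.bounded
  isMVD := A.isLCA.isMVD

/-- The complete local contact algebra of a complete MVD-algebra. -/
abbrev IISKAL.toISKAL (A : IISKAL.{u}) : ISKAL.{u} where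
  carrier := A.carrier
  contact := llContact A.ll
  bounded := {a | A.ll a ⊤}
  isLCA := A.isMVD.isLCA

theorem ISKAL.toISKAL_toIISKAL (A : ISKAL.{u}) : A.toIISKAL.toISKAL = A := by
  obtain ⟨B, ρ, bdd, h⟩ := A
  simp only [ISKAL.toIISKAL, IISKAL.toISKAL, ISKAL.mk.injEq, heq_eq_eq, true_and]
  exact ⟨llContact_boundedNonTang h, Set.ext (boundedNonTang_top h)⟩

theorem IISKAL.toIISKAL_toISKAL (A : IISKAL.{u}) : A.toISKAL.toIISKAL = A := by
  obtain ⟨B, ll, h⟩ := A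
  simp only [ISKAL.toIISKAL, IISKAL.toISKAL, IISKAL.mk.injEq, heq_eq_eq, true_and]
  exact boundedNonTang_llContact h

/-- A homomorphism satisfies the conditions on morphisms between MVD-algebras iff it satisfies
those between the corresponding local contact algebras. -/
theorem IISKAL.isISKALMorphism_toISKAL_iff {A B : IISKAL.{u}}
    (φ : CompleteLatticeHom A.carrier B.carrier) :
    IsISKALMorphism (A := A.toISKAL) (B := B.toISKAL) φ ↔ IsIISKALMorphism φ := by
  have key : ∀ a x : A.carrier, llContact A.ll x a ↔
      ∃ c, A.ll c ⊤ ∧ ¬ A.ll (x ⊓ c) (a ⊓ c)ᶜ := by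
    intro a x
    simp only [llContact, inf_comm]
  constructor
  · intro h
    -- Through `nonTang_llContact`, (S1) says that φ preserves non-tangential inclusion, which is
    -- the contrapositive of (L1) at a and b*.
    refine ⟨⟨fun a b hab d hd => ?_, h.L2⟩, fun U hU hUb => ?_⟩
    · rw [← nonTang_llContact (ll := A.ll)] at hab
      refine nonTang_llContact.1 (fun hn => hab (h.L1 _ _ ?_)) d hd
      rw [map_compl']
      exact hn
    · obtain ⟨c, hcU, hc⟩ := hUb
      obtain ⟨V, ⟨hV, c', hc'V, hc'⟩, hVU⟩ := h.IS U ⟨hU, c, hcU, hc⟩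
      exact ⟨V, hV, ⟨c', hc'V, hc'⟩, fun a ha b hb => (key _ _).1 (hVU _ ⟨b, hb, rfl⟩ a ha)⟩
  · intro h
    refine ⟨⟨fun a b hab => ?_, h.S2⟩, ?_⟩
    · by_contra hn
      have hn' : NonTang (llContact A.ll) a bᶜ := by
        unfold NonTang
        rwa [compl_compl]
      have h1 := nonTang_llContact.2 (h.S1 _ _ (nonTang_llContact.1 hn'))
      apply h1
      rw [map_compl', compl_compl]
      exact hab
    · rintro U ⟨hU, c, hcU, hc⟩
      obtain ⟨V, hV, ⟨c', hc'V, hc'⟩, hVU⟩ := h.IS' U hU ⟨c, hcU, hc⟩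
      refine ⟨V, ⟨hV, c', hc'V, hc'⟩, ?_⟩
      rintro _ ⟨b, hb, rfl⟩ a ha
      exact (key _ _).2 (hVU a ha b hb)

/-- `A.toIISKAL.toISKAL` has the carrier of `A`, but its contact relation and bounded set are only
propositionally those of `A`. Keeping the carriers fixed allows plain substitution. -/
theorem isISKALMorphism_congr {A B : Type u} [CompleteBooleanAlgebra A] [CompleteBooleanAlgebra B]
    {ρ ρ' : A → A → Prop} {η η' : B → B → Prop} {bdd bdd' : Set A} {bde bde' : Set B}
    (hA : IsLCA ρ bdd) (hA' : IsLCA ρ' bdd') (hB : IsLCA η bde) (hB' : IsLCA η' bde')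
    (h₁ : ρ = ρ') (h₂ : η = η') (h₃ : bdd = bdd') (h₄ : bde = bde') (φ : CompleteLatticeHom A B) :
    IsISKALMorphism (A := ⟨A, ρ, bdd, hA⟩) (B := ⟨B, η, bde, hB⟩) φ ↔
      IsISKALMorphism (A := ⟨A, ρ', bdd', hA'⟩) (B := ⟨B, η', bde', hB'⟩) φ := by
  subst h₁ h₂ h₃ h₄
  rfl

theorem ISKAL.isIISKALMorphism_toIISKAL_iff {A B : ISKAL.{u}}
    (φ : CompleteLatticeHom A.carrier B.carrier) :
    IsIISKALMorphism (A := A.toIISKAL) (B := B.toIISKAL) φ ↔ IsISKALMorphism φ := by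
  rw [← IISKAL.isISKALMorphism_toISKAL_iff]
  exact isISKALMorphism_congr _ A.isLCA _ B.isLCA (llContact_boundedNonTang A.isLCA)
    (llContact_boundedNonTang B.isLCA) (Set.ext (boundedNonTang_top A.isLCA))
    (Set.ext (boundedNonTang_top B.isLCA)) φ

/-- The isomorphism from local contact algebras to MVD-algebras. -/
def iskalToIISKAL : ISKAL.{u} ⥤ IISKAL.{u} where
  obj A := A.toIISKAL
  map {A B} f := ⟨f.hom, (ISKAL.isIISKALMorphism_toIISKAL_iff f.hom).2 f.isMorphism⟩

/-- The isomorphism from MVD-algebras to local contact algebras. -/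
def iiskalToISKAL : IISKAL.{u} ⥤ ISKAL.{u} where
  obj A := A.toISKAL
  map {A B} f := ⟨f.hom, (IISKAL.isISKALMorphism_toISKAL_iff f.hom).2 f.isMorphism⟩

theorem iskalToIISKAL_comp_iiskalToISKAL :
    iskalToIISKAL ⋙ iiskalToISKAL = 𝟭 ISKAL.{u} := by
  refine Functor.hext ISKAL.toISKAL_toIISKAL fun A B f => ?_
  -- The objects agree only propositionally, so morphisms are compared by heterogeneous equality,
  -- which reduces to that of the unchanged homomorphisms.
  have aux : ∀ {A A' B B' : ISKAL.{u}} (f : A' ⟶ B') (g : A ⟶ B), A' = A → B' = B →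
      HEq f.hom g.hom → HEq f g := by
    rintro A _ B _ ⟨f, _⟩ ⟨g, _⟩ rfl rfl h
    cases h
    rfl
  exact aux _ _ (ISKAL.toISKAL_toIISKAL A) (ISKAL.toISKAL_toIISKAL B) HEq.rfl

theorem iiskalToISKAL_comp_iskalToIISKAL :
    iiskalToISKAL ⋙ iskalToIISKAL = 𝟭 IISKAL.{u} := by
  refine Functor.hext IISKAL.toIISKAL_toISKAL fun A B f => ?_
  have aux : ∀ {A A' B B' : IISKAL.{u}} (f : A' ⟶ B') (g : A ⟶ B), A' = A → B' = B →
      HEq f.hom g.hom → HEq f g := by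
    rintro A _ B _ ⟨f, _⟩ ⟨g, _⟩ rfl rfl h
    cases h
    rfl
  exact aux _ _ (IISKAL.toIISKAL_toISKAL A) (IISKAL.toIISKAL_toISKAL B) HEq.rfl

/-- The equivalence between local contact algebras and MVD-algebras. -/
def iskalEquivIISKAL : ISKAL.{u} ≌ IISKAL.{u} :=
  CategoryTheory.Equivalence.mk iskalToIISKAL iiskalToISKAL
    (eqToIso iskalToIISKAL_comp_iiskalToISKAL.symm) (eqToIso iiskalToISKAL_comp_iskalToIISKAL)

/-! ## Ultrafilters of Boolean algebras -/

section Ultrafilter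

variable {B : Type*} [BooleanAlgebra B]

/-- The complement of a prime ideal that separates the filter from the ideal is an ultrafilter. -/
theorem exists_isUltrafilter_of_disjoint (F : Order.PFilter B) (I : Order.Ideal B)
    (h : Disjoint (F : Set B) I) :
    ∃ U : Set B, IsUltrafilter U ∧ (F : Set B) ⊆ U ∧ Disjoint U I := by
  obtain ⟨J, hJ, hIJ, hFJ⟩ := DistribLattice.prime_ideal_of_disjoint_filter_ideal h
  refine ⟨(J : Set B)ᶜ, ⟨?_, ?_, ?_, ?_, ?_⟩, hFJ.subset_compl_right, ?_⟩
  · exact fun hJ' => disjoint_left.1 hFJ Order.PFilter.top_mem hJ'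
  · exact fun hn => hn (Order.Ideal.bot_mem J)
  · exact fun a b hab ha hb => ha (J.lower hab hb)
  · exact fun a b ha hb hab => (hJ.mem_or_mem hab).elim ha hb
  · intro a
    by_contra! hn
    simp only [mem_compl_iff, not_not] at hn
    have h1 := Order.Ideal.sup_mem hn.1 hn.2
    rw [sup_compl_eq_top] at h1
    exact disjoint_left.1 hFJ Order.PFilter.top_mem h1
  · exact disjoint_left.2 fun a ha haI => ha (hIJ haI)

theorem IsUltrafilter.compl_notMem {U : Set B} (hU : IsUltrafilter U) {a : B} (ha : a ∈ U) :
    aᶜ ∉ U := by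
  intro h
  have := hU.inf_mem _ _ ha h
  rw [inf_compl_eq_bot] at this
  exact hU.bot_notMem this

theorem IsUltrafilter.mem_of_compl_notMem {U : Set B} (hU : IsUltrafilter U) {a : B}
    (ha : aᶜ ∉ U) : a ∈ U :=
  (hU.mem_or_compl_mem a).resolve_right ha

/-- A proper filter is contained in an ultrafilter. -/
theorem exists_isUltrafilter_superset (F : Order.PFilter B) (h : ⊥ ∉ F) :
    ∃ U : Set B, IsUltrafilter U ∧ (F : Set B) ⊆ U := by
  obtain ⟨U, hU, hFU, -⟩ := exists_isUltrafilter_of_disjoint F ⊥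
    (disjoint_left.2 fun a ha ha' => h (by
      have : a = ⊥ := le_bot_iff.1 ha'
      rwa [← this]))
  exact ⟨U, hU, hFU⟩

end Ultrafilter

/-! ## Regular open sets -/

/-- The regular elements of a frame form a complete Boolean algebra. -/
@[reducible]
noncomputable def regularCompleteBooleanAlgebra (α : Type*) [Order.Frame α] :
    CompleteBooleanAlgebra (Heyting.Regular α) :=
  let L : CompleteLattice (Heyting.Regular α) := Heyting.Regular.gi.liftCompleteLattice
  { (inferInstance : BooleanAlgebra (Heyting.Regular α)) with
    sSup := L.sSup
    sInf := L.sInf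
    isLUB_sSup := L.isLUB_sSup
    isGLB_sInf := L.isGLB_sInf }

/-- The complete Boolean algebra of regular open subsets of a space. -/
def RegularOpens (X : Type*) [TopologicalSpace X] : Type _ :=
  Heyting.Regular (Opens X)

noncomputable instance (X : Type*) [TopologicalSpace X] :
    CompleteBooleanAlgebra (RegularOpens X) :=
  regularCompleteBooleanAlgebra (Opens X)

namespace RegularOpens

section Basic

variable {X : Type*} [TopologicalSpace X]

/-- The underlying set of a regular open set. -/
def toSet (U : RegularOpens X) : Set X := (Heyting.Regular.val U : Opens X)

theorem isOpen (U : RegularOpens X) : IsOpen U.toSet := (Heyting.Regular.val U).isOpen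

theorem le_iff {U V : RegularOpens X} : U ≤ V ↔ U.toSet ⊆ V.toSet := Iff.rfl

theorem ext_toSet {U V : RegularOpens X} (h : U.toSet = V.toSet) : U = V :=
  le_antisymm (le_iff.2 h.subset) (le_iff.2 h.superset)

theorem coe_compl_opens (U : Opens X) : ((Uᶜ : Opens X) : Set X) = (closure (U : Set X))ᶜ := by
  rw [← Opens.interior_compl, Opens.coe_interior, interior_compl]

theorem toSet_compl (U : RegularOpens X) : Uᶜ.toSet = (closure U.toSet)ᶜ :=
  coe_compl_opens _

theorem toSet_bot : (⊥ : RegularOpens X).toSet = ∅ := rfl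

theorem interior_closure (U : RegularOpens X) : interior (closure U.toSet) = U.toSet := by
  have h := congrArg toSet (compl_compl U)
  rw [toSet_compl, toSet_compl, closure_compl, compl_compl] at h
  exact h

theorem closure_toSet_compl (U : RegularOpens X) : closure Uᶜ.toSet = U.toSetᶜ := by
  rw [toSet_compl, closure_compl, interior_closure]

theorem nonempty_iff {U : RegularOpens X} : U.toSet.Nonempty ↔ U ≠ ⊥ := by
  rw [nonempty_iff_ne_empty, not_iff_not]
  exact ⟨fun h => ext_toSet h, fun h => h ▸ rfl⟩

/-- The interior of the closure of a set. -/
def intCl (s : Set X) : RegularOpens X :=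
  ⟨⟨interior (closure s), isOpen_interior⟩, by
    apply Opens.ext
    rw [coe_compl_opens, coe_compl_opens, closure_compl, compl_compl]
    exact interior_closure_idem⟩

theorem toSet_intCl (s : Set X) : (intCl s).toSet = interior (closure s) := rfl

theorem subset_intCl {s : Set X} (hs : IsOpen s) : s ⊆ (intCl s).toSet :=
  hs.subset_interior_closure

/-- Contact and boundedness depend on closures alone, so they can be tested on any open set before
regularization. -/
theorem closure_intCl {s : Set X} (hs : IsOpen s) : closure (intCl s).toSet = closure s := by
  rw [toSet_intCl]
  exact (closure_minimal interior_subset isClosed_closure).antisymm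
    (closure_mono hs.subset_interior_closure)

theorem intCl_le {s : Set X} {U : RegularOpens X} (h : s ⊆ closure U.toSet) : intCl s ≤ U := by
  rw [le_iff, toSet_intCl, ← U.interior_closure]
  exact interior_mono (closure_minimal h isClosed_closure)

theorem intCl_toSet (U : RegularOpens X) : intCl U.toSet = U :=
  ext_toSet U.interior_closure

theorem sSup_eq (S : Set (RegularOpens X)) : sSup S = intCl (⋃ U ∈ S, U.toSet) := by
  apply le_antisymm
  · refine sSup_le fun U hU => ?_
    exact (subset_biUnion_of_mem (u := toSet) hU).trans
      (subset_intCl (isOpen_biUnion fun U _ => U.isOpen))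
  · exact intCl_le (iUnion₂_subset fun U hU => subset_closure.trans' (le_iff.1 (le_sSup hU)))

theorem sup_eq (U V : RegularOpens X) : U ⊔ V = intCl (U.toSet ∪ V.toSet) := by
  apply le_antisymm
  · exact sup_le (subset_union_left.trans (subset_intCl (U.isOpen.union V.isOpen)))
      (subset_union_right.trans (subset_intCl (U.isOpen.union V.isOpen)))
  · exact intCl_le (union_subset (subset_closure.trans' (le_iff.1 le_sup_left))
      (subset_closure.trans' (le_iff.1 le_sup_right)))

theorem closure_sup (U V : RegularOpens X) :
    closure (U ⊔ V).toSet = closure U.toSet ∪ closure V.toSet := by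
  rw [sup_eq, closure_intCl (U.isOpen.union V.isOpen), closure_union]

/-- Two regular open sets are in contact if their closures meet. -/
def Contact (U V : RegularOpens X) : Prop :=
  (closure U.toSet ∩ closure V.toSet).Nonempty

theorem nonTang_iff {U V : RegularOpens X} :
    NonTang Contact U V ↔ closure U.toSet ⊆ V.toSet := by
  rw [NonTang, Contact, closure_toSet_compl, not_nonempty_iff_eq_empty, ← sdiff_eq,
    sdiff_eq_empty]

theorem isContact : IsContact (Contact (X := X)) where
  C1 U hU := by
    rw [Contact, inter_self]
    exact (nonempty_iff.2 hU).closure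
  C2 U V h := by
    refine ⟨?_, ?_⟩ <;> rintro rfl <;> simp [Contact, toSet_bot] at h
  C3 U V h := by rwa [Contact, inter_comm]
  C4 U V W := by
    rw [Contact, closure_sup, inter_union_distrib_left, union_nonempty]
    rfl

variable (X) in
/-- The regular open sets with compact closure. -/
def bounded : Set (RegularOpens X) := {U | IsCompact (closure U.toSet)}

end Basic

/-! ### Regular open sets of a locally compact Hausdorff space -/

section LocallyCompact

variable {X : Type*} [TopologicalSpace X] [LocallyCompactSpace X] [T2Space X]

theorem exists_between {K U : Set X} (hK : IsCompact K) (hU : IsOpen U) (hKU : K ⊆ U) :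
    ∃ V ∈ bounded X, K ⊆ V.toSet ∧ closure V.toSet ⊆ U := by
  obtain ⟨V, hV, hKV, hVU, hVc⟩ := exists_open_between_and_isCompact_closure hK hU hKU
  refine ⟨intCl V, ?_, hKV.trans (subset_intCl hV), ?_⟩
  · rwa [bounded, mem_ofPred_eq, closure_intCl hV]
  · rwa [closure_intCl hV]

theorem exists_mem_closure_subset {x : X} {U : Set X} (hU : IsOpen U) (hx : x ∈ U) :
    ∃ V ∈ bounded X, x ∈ V.toSet ∧ closure V.toSet ⊆ U := by
  simpa using exists_between isCompact_singleton hU (singleton_subset_iff.2 hx)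

theorem isLCA : IsLCA (Contact (X := X)) (bounded X) where
  toIsContact := isContact
  BB1 := by simp [bounded, toSet_bot]
  BB2 U V hUV hV := hV.of_isClosed_subset isClosed_closure (closure_mono hUV)
  BB3 U V hU hV := by
    rw [bounded, mem_ofPred_eq, closure_sup]
    exact hU.union hV
  BC1 U W hU hUW := by
    rw [nonTang_iff] at hUW
    obtain ⟨V, hV, hUV, hVW⟩ := exists_between hU W.isOpen hUW
    exact ⟨V, hV, nonTang_iff.2 hUV, nonTang_iff.2 hVW⟩
  BC2 U V := by
    rintro ⟨x, hxU, hxV⟩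
    obtain ⟨W, hW, hxW, -⟩ := exists_mem_closure_subset isOpen_univ (mem_univ x)
    exact ⟨W, hW, x, hxU, W.isOpen.inter_closure ⟨hxW, hxV⟩⟩
  BC3 U hU := by
    obtain ⟨x, hx⟩ := nonempty_iff.2 hU
    obtain ⟨V, hV, hxV, hVU⟩ := exists_mem_closure_subset U.isOpen hx
    exact ⟨V, hV, nonempty_iff.1 ⟨x, hxV⟩, nonTang_iff.2 hVU⟩

/-- An ultrafilter with a bounded element has a limit. -/
theorem exists_forall_mem_closure {u : Set (RegularOpens X)} (hu : IsUltrafilter u)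
    (hb : (u ∩ bounded X).Nonempty) : ∃ x, ∀ U ∈ u, x ∈ closure U.toSet := by
  obtain ⟨W, hWu, hW⟩ := hb
  have : Nonempty u := ⟨⟨W, hWu⟩⟩
  -- Cutting every member down by the bounded member W makes the closures compact without leaving
  -- the ultrafilter.
  obtain ⟨x, hx⟩ := IsCompact.nonempty_iInter_of_directed_nonempty_isCompact_isClosed
    (fun U : u => closure ((U : RegularOpens X) ⊓ W).toSet)
    (fun U V => ⟨⟨U ⊓ V, hu.inf_mem _ _ U.2 V.2⟩,
      closure_mono (le_iff.1 (inf_le_inf_right _ inf_le_left)),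
      closure_mono (le_iff.1 (inf_le_inf_right _ inf_le_right))⟩)
    (fun U => (nonempty_iff.2 fun h =>
      hu.bot_notMem (h ▸ hu.inf_mem _ _ U.2 hWu)).closure)
    (fun U => isLCA.BB2 _ _ inf_le_right hW) (fun U => isClosed_closure)
  exact ⟨x, fun U hU => closure_mono (le_iff.1 inf_le_left) (mem_iInter.1 hx ⟨U, hU⟩)⟩

/-- Every point is the limit of a bounded ultrafilter. -/
theorem exists_isUltrafilter_of_point (x : X) : ∃ u : Set (RegularOpens X), IsUltrafilter u ∧
    (u ∩ bounded X).Nonempty ∧ ∀ U : RegularOpens X, x ∈ U.toSet → U ∈ u := by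
  have hF : Order.IsPFilter {U : RegularOpens X | x ∈ U.toSet} :=
    Order.IsPFilter.of_def ⟨⊤, mem_univ x⟩
      (fun U hU V hV => ⟨U ⊓ V, ⟨hU, hV⟩, inf_le_left, inf_le_right⟩)
      (fun hUV hU => hUV hU)
  obtain ⟨u, hu, hFu⟩ := exists_isUltrafilter_superset hF.toPFilter (notMem_empty x)
  obtain ⟨W, hW, hxW, -⟩ := exists_mem_closure_subset isOpen_univ (mem_univ x)
  exact ⟨u, hu, ⟨W, hFu hxW, hW⟩, fun U hU => hFu hU⟩

end LocallyCompact

end RegularOpens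

/-! ### Skeletal maps and their action on regular open sets -/

/-- The image of a nonempty open set is dense in some nonempty open set, which D meets in a nonempty
open set; so the image meets D. -/
theorem IsSkeletal.dense_preimage {X Y : Type*} [TopologicalSpace X] [TopologicalSpace Y]
    {f : X → Y} (hf : IsSkeletal f) {D : Set Y} (hD : IsOpen D) (hd : Dense D) :
    Dense (f ⁻¹' D) := by
  refine dense_iff_inter_open.2 fun W hW hne => ?_
  obtain ⟨y, hy, hyD⟩ := dense_iff_inter_open.1 hd _ isOpen_interior (hf W hW hne)
  obtain ⟨_, hD', w, hw, rfl⟩ := mem_closure_iff.1 (interior_subset hy) D hD hyD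
  exact ⟨w, hw, hD'⟩

theorem dense_union_compl_closure {X : Type*} [TopologicalSpace X] (s : Set X) :
    Dense (s ∪ (closure s)ᶜ) := by
  intro x
  rw [closure_union]
  by_cases hx : x ∈ closure s
  · exact Or.inl hx
  · exact Or.inr (subset_closure hx)

namespace RegularOpens

section Map

variable {X Y Z : Type*} [TopologicalSpace X] [TopologicalSpace Y] [TopologicalSpace Z]
  {f : X → Y}

/-- The preimage of the frontier of V is negligible: up to closure, a point of O may be assumed to
land in V or outside cl V. -/
theorem inter_preimage_subset (hf : IsSkeletal f) {O : Set X} (hO : IsOpen O) {V : Set Y}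
    (hV : IsOpen V) : O ⊆ closure (O ∩ f ⁻¹' (V ∪ (closure V)ᶜ)) :=
  (hf.dense_preimage (hV.union isClosed_closure.isOpen_compl)
    (dense_union_compl_closure V)).open_subset_closure_inter hO

theorem preimage_interior_closure_subset (hf : IsSkeletal f) (hfc : Continuous f) {V : Set Y}
    (hV : IsOpen V) : f ⁻¹' interior (closure V) ⊆ closure (f ⁻¹' V) := by
  refine (inter_preimage_subset hf (isOpen_interior.preimage hfc) hV).trans (closure_mono ?_)
  rintro x ⟨hx, hx' | hx'⟩
  · exact hx'
  · exact (hx' (interior_subset hx)).elim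

theorem intCl_preimage_compl (hf : IsSkeletal f) (hfc : Continuous f) (U : RegularOpens Y) :
    intCl (f ⁻¹' Uᶜ.toSet) = (intCl (f ⁻¹' U.toSet))ᶜ := by
  apply le_antisymm
  · apply intCl_le
    refine subset_closure.trans' ?_
    rw [toSet_compl U, toSet_compl, closure_intCl (U.isOpen.preimage hfc), preimage_compl,
      compl_subset_compl]
    exact hfc.closure_preimage_subset _
  · rw [le_iff, toSet_compl, closure_intCl (U.isOpen.preimage hfc), toSet_compl, toSet_intCl]
    refine interior_maximal ?_ isClosed_closure.isOpen_compl
    refine (inter_preimage_subset hf isClosed_closure.isOpen_compl U.isOpen).trans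
      (closure_mono ?_)
    rintro x ⟨hx, hx' | hx'⟩
    · exact (hx (subset_closure hx')).elim
    · exact hx'

theorem intCl_preimage_sSup (hf : IsSkeletal f) (hfc : Continuous f)
    (S : Set (RegularOpens Y)) :
    intCl (f ⁻¹' (sSup S).toSet) = sSup ((fun U => intCl (f ⁻¹' U.toSet)) '' S) := by
  apply le_antisymm
  · apply intCl_le
    rw [sSup_eq, toSet_intCl]
    refine (preimage_interior_closure_subset hf hfc
      (isOpen_biUnion fun U _ => U.isOpen)).trans (closure_mono ?_)
    rw [preimage_iUnion₂]
    refine iUnion₂_subset fun U hU => ?_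
    exact (subset_intCl (U.isOpen.preimage hfc)).trans
      (le_iff.1 (le_sSup (mem_image_of_mem _ hU)))
  · apply sSup_le
    rintro _ ⟨U, hU, rfl⟩
    exact intCl_le ((preimage_mono (le_iff.1 (le_sSup hU))).trans
      ((subset_intCl ((sSup S).isOpen.preimage hfc)).trans subset_closure))

/-- The complete homomorphism `U ↦ int (cl (f⁻¹ U))` of a continuous skeletal map `f`. -/
noncomputable def comap (hf : IsSkeletal f) (hfc : Continuous f) :
    CompleteLatticeHom (RegularOpens Y) (RegularOpens X) where
  toFun U := intCl (f ⁻¹' U.toSet)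
  map_sSup' := intCl_preimage_sSup hf hfc
  map_sInf' S := by
    -- Meets follow from joins by complementation.
    have h := intCl_preimage_sSup hf hfc (compl '' S)
    rw [← compl_inj_iff, ← intCl_preimage_compl hf hfc, compl_sInf', compl_sInf', h, image_image,
      image_image]
    exact congrArg sSup (image_congr fun U _ => intCl_preimage_compl hf hfc U)

theorem comap_apply (hf : IsSkeletal f) (hfc : Continuous f) (U : RegularOpens Y) :
    comap hf hfc U = intCl (f ⁻¹' U.toSet) := rfl

theorem preimage_subset_comap (hf : IsSkeletal f) (hfc : Continuous f) (U : RegularOpens Y) :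
    f ⁻¹' U.toSet ⊆ (comap hf hfc U).toSet :=
  subset_intCl (U.isOpen.preimage hfc)

theorem closure_comap_subset (hf : IsSkeletal f) (hfc : Continuous f) (U : RegularOpens Y) :
    closure (comap hf hfc U).toSet ⊆ f ⁻¹' closure U.toSet := by
  rw [comap_apply, closure_intCl (U.isOpen.preimage hfc)]
  exact hfc.closure_preimage_subset _

theorem comap_comp {g : Y → Z} (hg : IsSkeletal g) (hgc : Continuous g) (hf : IsSkeletal f)
    (hfc : Continuous f) : comap (hg.comp hgc hf) (hgc.comp hfc) =
      (comap hf hfc).comp (comap hg hgc) := by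
  refine DFunLike.ext _ _ fun U => ?_
  apply le_antisymm
  · apply intCl_le
    exact ((preimage_mono (preimage_subset_comap hg hgc U)).trans
      (preimage_subset_comap hf hfc _)).trans subset_closure
  · apply intCl_le
    refine (preimage_interior_closure_subset hf hfc (U.isOpen.preimage hgc)).trans
      (closure_mono ?_)
    exact preimage_subset_comap (hg.comp hgc hf) (hgc.comp hfc) U

end Map

end RegularOpens

/-! ### The contravariant functor of regular open sets -/

/-- The complete local contact algebra of regular open sets of a space. -/
noncomputable abbrev SSKLC.toISKAL (X : SSKLC.{u}) : ISKAL.{u} where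
  carrier := RegularOpens X.carrier
  contact := RegularOpens.Contact
  bounded := RegularOpens.bounded X.carrier
  isLCA := RegularOpens.isLCA

open RegularOpens in
-- For (L2), f(cl U) is compact, hence lies in some bounded V, and the lower adjoint sends U below
-- V. For (IS), surjectivity lifts the limit y of u to a point x, and any ultrafilter refining the
-- neighbourhoods of x will do.
theorem isISKALMorphism_comap {X Y : SSKLC.{u}} (f : SSKLC.Hom X Y) :
    IsISKALMorphism (A := Y.toISKAL) (B := X.toISKAL) (comap f.skeletal f.continuous) where
  L1 U V := by
    rintro ⟨x, hxU, hxV⟩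
    exact ⟨f.toFun x, closure_comap_subset f.skeletal f.continuous _ hxU,
      closure_comap_subset f.skeletal f.continuous _ hxV⟩
  L2 U hU := by
    obtain ⟨V, hV, hUV, -⟩ := exists_between (IsCompact.image hU f.continuous) isOpen_univ
      (subset_univ _)
    refine isLCA.BB2 _ _ ((lowerAdj_gc _).l_le (?_ : U ≤ _)) hV
    exact ((image_subset_iff.1 hUV).trans (preimage_subset_comap _ _ _)).trans' subset_closure
  IS u hu := by
    obtain ⟨y, hy⟩ := exists_forall_mem_closure hu.1 hu.2
    obtain ⟨x, rfl⟩ := f.surjective y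
    obtain ⟨v, hv, hvb, hxv⟩ := exists_isUltrafilter_of_point x
    refine ⟨v, ⟨hv, hvb⟩, ?_⟩
    rintro _ ⟨V, hV, rfl⟩ U hU
    refine ⟨f.toFun x, ?_, hy U hU⟩
    have hx : x ∈ closure V.toSet := by
      by_contra hx
      rw [← mem_compl_iff, ← toSet_compl] at hx
      exact hv.compl_notMem hV (hxv _ hx)
    exact closure_comap_subset f.skeletal f.continuous _ (closure_mono ((lowerAdj_gc
      (comap f.skeletal f.continuous)).le_u_l V) hx)

/-- The contravariant functor assigning to a space its algebra of regular open sets. -/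
noncomputable def regularOpensFunctor : SSKLC.{u}ᵒᵖ ⥤ ISKAL.{u} where
  obj X := X.unop.toISKAL
  map f := ⟨RegularOpens.comap f.unop.skeletal f.unop.continuous, isISKALMorphism_comap f.unop⟩
  map_id _ := ISKAL.Hom.ext (DFunLike.ext _ _ fun U => RegularOpens.intCl_toSet U)
  map_comp f g := ISKAL.Hom.ext (RegularOpens.comap_comp f.unop.skeletal f.unop.continuous
    g.unop.skeletal g.unop.continuous)

/-- If f x ≠ g x, a small regular open U around f x has closure avoiding g x; then x lies in the
image of U under f's homomorphism but not under g's. -/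
instance : regularOpensFunctor.{u}.Faithful where
  map_injective {X Y} f g h := by
    apply Quiver.Hom.unop_inj
    refine SSKLC.Hom.ext (funext fun x => ?_)
    by_contra hne
    obtain ⟨O, O', hO, hO', hx, hx', hd⟩ := t2_separation hne
    obtain ⟨U, -, hxU, hU⟩ := RegularOpens.exists_mem_closure_subset hO hx
    have h1 := RegularOpens.preimage_subset_comap f.unop.skeletal f.unop.continuous U hxU
    have h2 : RegularOpens.comap f.unop.skeletal f.unop.continuous =
      RegularOpens.comap g.unop.skeletal g.unop.continuous := congrArg ISKAL.Hom.hom h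
    rw [h2] at h1
    exact disjoint_left.1 hd (hU (RegularOpens.closure_comap_subset g.unop.skeletal g.unop.continuous _
      (subset_closure h1)))
      hx'

/-! ## Isomorphisms of local contact algebras -/

theorem isISKALMorphism_orderIso {A B : ISKAL.{u}} (e : A.carrier ≃o B.carrier)
    (hc : ∀ a b, B.contact (e a) (e b) ↔ A.contact a b)
    (hb : ∀ a, e a ∈ B.bounded ↔ a ∈ A.bounded) :
    IsISKALMorphism (A := A) (B := B)
      (CompleteLatticeHom.OrderIso.toCompleteLatticeHom e) := by
  have hl : ∀ b, lowerAdj (CompleteLatticeHom.OrderIso.toCompleteLatticeHom e) b = e.symm b :=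
    fun b => (lowerAdj_gc _).l_unique e.symm.to_galoisConnection fun _ => rfl
  refine ⟨⟨fun a b => (hc a b).1, fun b hbb => ?_⟩, fun U hU => ⟨e '' U, ⟨⟨?_, ?_, ?_, ?_, ?_⟩, ?_⟩,
    ?_⟩⟩
  · rw [hl, ← hb, e.apply_symm_apply]
    exact hbb
  · exact ⟨⊤, hU.1.top_mem, e.map_top⟩
  · rintro ⟨a, ha, h⟩
    rw [map_eq_bot_iff] at h
    exact hU.1.bot_notMem (h ▸ ha)
  · rintro _ b hab ⟨a, ha, rfl⟩
    exact ⟨e.symm b, hU.1.mem_of_le _ _ ((e.le_symm_apply).2 hab) ha, e.apply_symm_apply b⟩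
  · rintro _ _ ⟨a, ha, rfl⟩ ⟨b, hb, rfl⟩
    exact ⟨a ⊓ b, hU.1.inf_mem _ _ ha hb, e.map_inf a b⟩
  · intro b
    obtain ⟨a, rfl⟩ := e.surjective b
    refine (hU.1.mem_or_compl_mem a).imp (fun h => ⟨a, h, rfl⟩) fun h => ⟨aᶜ, h, ?_⟩
    exact map_compl' e a
  · obtain ⟨a, ha, hab⟩ := hU.2
    exact ⟨e a, ⟨a, ha, rfl⟩, (hb a).2 hab⟩
  · rintro _ ⟨_, ⟨b, hbU, rfl⟩, rfl⟩ a ha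
    rw [hl, e.symm_apply_apply]
    refine A.isLCA.of_inf_ne_bot fun h => hU.1.bot_notMem ?_
    rw [← h]
    exact hU.1.inf_mem _ _ hbU ha

/-- An order isomorphism preserving and reflecting contact and boundedness is an isomorphism of
local contact algebras. -/
def ISKAL.isoOfOrderIso {A B : ISKAL.{u}} (e : A.carrier ≃o B.carrier)
    (hc : ∀ a b, B.contact (e a) (e b) ↔ A.contact a b)
    (hb : ∀ a, e a ∈ B.bounded ↔ a ∈ A.bounded) : A ≅ B where
  hom := ⟨CompleteLatticeHom.OrderIso.toCompleteLatticeHom e, isISKALMorphism_orderIso e hc hb⟩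
  inv := ⟨CompleteLatticeHom.OrderIso.toCompleteLatticeHom e.symm, isISKALMorphism_orderIso e.symm
    (fun a b => by simpa using (hc (e.symm a) (e.symm b)).symm)
    (fun a => by simpa using (hb (e.symm a)).symm)⟩
  hom_inv_id := ISKAL.Hom.ext (DFunLike.ext _ _ e.symm_apply_apply)
  inv_hom_id := ISKAL.Hom.ext (DFunLike.ext _ _ e.apply_symm_apply)

/-! ## The space of points of a local contact algebra -/

/-- A point of a local contact algebra: a round prime filter. -/
@[ext]
structure ISKAL.Point (A : ISKAL.{u}) : Type u where
  carrier : Set A.carrier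
  top_mem : ⊤ ∈ carrier
  bot_notMem : ⊥ ∉ carrier
  mem_of_le : ∀ a b, a ≤ b → a ∈ carrier → b ∈ carrier
  inf_mem : ∀ a b, a ∈ carrier → b ∈ carrier → a ⊓ b ∈ carrier
  round : ∀ a ∈ carrier, ∃ b ∈ carrier, b ∈ A.bounded ∧ NonTang A.contact b a
  prime : ∀ a b, a ∈ A.bounded → NonTang A.contact a b → aᶜ ∈ carrier ∨ b ∈ carrier

namespace ISKAL.Point

variable {A B : ISKAL.{u}}

theorem compl_notMem (p : A.Point) {a : A.carrier} (ha : a ∈ p.carrier) : aᶜ ∉ p.carrier := by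
  intro h
  have := p.inf_mem _ _ ha h
  rw [inf_compl_eq_bot] at this
  exact p.bot_notMem this

/-- Roundness at the top supplies a bounded c in p, so primality applies to a ∧ c; meeting (a ∧ c)*
with c leaves an element below a*. -/
theorem compl_mem_or_mem (p : A.Point) {a b : A.carrier} (h : NonTang A.contact a b) :
    aᶜ ∈ p.carrier ∨ b ∈ p.carrier := by
  obtain ⟨c, hcp, hc, -⟩ := p.round _ p.top_mem
  refine (p.prime (a ⊓ c) b (A.isLCA.BB2 _ _ inf_le_right hc)
    (h.mono A.isLCA.toIsContact inf_le_left le_rfl)).imp (fun h1 => ?_) id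
  refine p.mem_of_le _ _ ?_ (p.inf_mem _ _ h1 hcp)
  rw [compl_inf, inf_sup_right, compl_inf_eq_bot, sup_bot_eq]
  exact inf_le_left

theorem isPFilter (p : A.Point) : Order.IsPFilter p.carrier :=
  Order.IsPFilter.of_def ⟨⊤, p.top_mem⟩
    (fun a ha b hb => ⟨a ⊓ b, p.inf_mem a b ha hb, inf_le_left, inf_le_right⟩)
    (fun {a b} hab ha => p.mem_of_le a b hab ha)

/-- The point determined by a bounded ultrafilter. -/
def ofUltrafilter (u : Set A.carrier) (hu : IsBoundedUltrafilter A u) : A.Point where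
  carrier := {a | ∃ b ∈ u, b ∈ A.bounded ∧ NonTang A.contact b a}
  top_mem := by
    obtain ⟨c, hc, hcb⟩ := hu.2
    exact ⟨c, hc, hcb, NonTang.top A.isLCA.toIsContact⟩
  bot_notMem := by
    rintro ⟨b, hb, -, hb0⟩
    exact hu.1.bot_notMem (hu.1.mem_of_le _ _ (hb0.le A.isLCA.toIsContact) hb)
  mem_of_le := by
    rintro a b hab ⟨c, hc, hcb, hca⟩
    exact ⟨c, hc, hcb, hca.mono A.isLCA.toIsContact le_rfl hab⟩
  inf_mem := by
    rintro a b ⟨c, hc, hcb, hca⟩ ⟨d, hd, -, hdb⟩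
    exact ⟨c ⊓ d, hu.1.inf_mem _ _ hc hd, A.isLCA.BB2 _ _ inf_le_left hcb,
      (hca.mono A.isLCA.toIsContact inf_le_left le_rfl).inf A.isLCA.toIsContact
        (hdb.mono A.isLCA.toIsContact inf_le_right le_rfl)⟩
  round := by
    rintro a ⟨c, hc, hcb, hca⟩
    obtain ⟨b, hb, hcb', hba⟩ := A.isLCA.BC1 _ _ hcb hca
    exact ⟨b, ⟨c, hc, hcb, hcb'⟩, hb, hba⟩
  prime a b ha hab := by
    obtain ⟨e, he, hae, heb⟩ := A.isLCA.BC1 _ _ ha hab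
    obtain ⟨c, hc, hcb⟩ := hu.2
    rcases hu.1.mem_or_compl_mem e with h | h
    · exact Or.inr ⟨e, h, he, heb⟩
    · exact Or.inl ⟨c ⊓ eᶜ, hu.1.inf_mem _ _ hc h, A.isLCA.BB2 _ _ inf_le_left hcb,
        (hae.compl A.isLCA.toIsContact).mono A.isLCA.toIsContact inf_le_right le_rfl⟩

theorem exists_forall_mem {a : A.carrier} (ha : a ≠ ⊥) : ∃ p : A.Point, a ∈ p.carrier := by
  obtain ⟨b, hb, hb0, hba⟩ := A.isLCA.BC3 a ha
  obtain ⟨u, hu, hbu⟩ := exists_isUltrafilter_superset (Order.PFilter.principal b)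
    (fun h => hb0 (le_bot_iff.1 h))
  have hbu' : b ∈ u := hbu (Order.PFilter.mem_principal.2 le_rfl)
  exact ⟨ofUltrafilter u ⟨hu, b, hbu', hb⟩, b, hbu', hb, hba⟩

/-- The elements not in contact with a form an ideal. An ultrafilter avoiding it and containing b ∧
c, with c bounded from (BC2), determines the point. -/
theorem exists_of_contact {a b : A.carrier} (hab : A.contact a b) :
    ∃ p : A.Point, aᶜ ∉ p.carrier ∧ bᶜ ∉ p.carrier := by
  have hA := A.isLCA.toIsContact
  obtain ⟨c, hc, hac⟩ := A.isLCA.BC2 _ _ hab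
  have hI : Order.IsIdeal {d | ¬ A.contact a d} :=
    ⟨fun d e hed hd he => hd (hA.mono le_rfl hed he), ⟨⊥, fun h => (hA.C2 _ _ h).2 rfl⟩,
      fun d hd e he => ⟨d ⊔ e, fun h => ((hA.C4 _ _ _).1 h).elim hd he, le_sup_left,
        le_sup_right⟩⟩
  obtain ⟨u, hu, hcu, huI⟩ := exists_isUltrafilter_of_disjoint (Order.PFilter.principal (c ⊓ b))
    hI.toIdeal (disjoint_left.2 fun d hd hd' => hd' (hA.mono le_rfl hd hac))
  have hcbu : c ⊓ b ∈ u := hcu (Order.PFilter.mem_principal.2 le_rfl)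
  refine ⟨ofUltrafilter u ⟨hu, c ⊓ b, hcbu, A.isLCA.BB2 _ _ inf_le_left hc⟩, ?_, ?_⟩
  · rintro ⟨d, hd, -, hda⟩
    refine disjoint_left.1 huI hd fun h => hda (hA.C3 _ _ ?_)
    rwa [compl_compl]
  · rintro ⟨d, hd, -, hdb⟩
    exact hu.compl_notMem (hu.mem_of_le _ _ inf_le_right hcbu)
      (hu.mem_of_le _ _ (hdb.le hA) hd)

instance : TopologicalSpace A.Point where
  IsOpen S := ∀ p ∈ S, ∃ a ∈ p.carrier, ∀ q : A.Point, a ∈ q.carrier → q ∈ S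
  isOpen_univ p _ := ⟨⊤, p.top_mem, fun _ _ => trivial⟩
  isOpen_inter S T hS hT p hp := by
    obtain ⟨a, ha, haS⟩ := hS p hp.1
    obtain ⟨b, hb, hbT⟩ := hT p hp.2
    exact ⟨a ⊓ b, p.inf_mem _ _ ha hb, fun q hq => ⟨haS q (q.mem_of_le _ _ inf_le_left hq),
      hbT q (q.mem_of_le _ _ inf_le_right hq)⟩⟩
  isOpen_sUnion 𝒮 h𝒮 p := by
    rintro ⟨S, hS, hp⟩
    obtain ⟨a, ha, haS⟩ := h𝒮 S hS p hp
    exact ⟨a, ha, fun q hq => ⟨S, hS, haS q hq⟩⟩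

/-- The basic open set of points containing `a`. -/
def basic (a : A.carrier) : Set A.Point := {p | a ∈ p.carrier}

theorem isOpen_iff {S : Set A.Point} :
    IsOpen S ↔ ∀ p ∈ S, ∃ a ∈ p.carrier, basic a ⊆ S := Iff.rfl

theorem isOpen_basic (a : A.carrier) : IsOpen (basic a) :=
  isOpen_iff.2 fun _ hp => ⟨a, hp, Subset.rfl⟩

theorem basic_inf (a b : A.carrier) : basic (a ⊓ b) = basic a ∩ basic b :=
  Set.ext fun p => ⟨fun h => ⟨p.mem_of_le _ _ inf_le_left h, p.mem_of_le _ _ inf_le_right h⟩,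
    fun h => p.inf_mem _ _ h.1 h.2⟩

theorem basic_mono {a b : A.carrier} (h : a ≤ b) : basic a ⊆ basic b :=
  fun p => p.mem_of_le _ _ h

theorem basic_nonempty_iff {a : A.carrier} : (basic a).Nonempty ↔ a ≠ ⊥ :=
  ⟨fun ⟨p, hp⟩ h => p.bot_notMem (h ▸ hp), exists_forall_mem⟩

/-- If p lacks a*, then no b in p is disjoint from a, so b ∧ a ≠ 0 lies in some point and every
basic neighbourhood of p meets `basic a`. -/
theorem closure_basic (a : A.carrier) : closure (basic a) = (basic aᶜ)ᶜ := by
  apply subset_antisymm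
  · refine closure_minimal (fun p hp => p.compl_notMem hp) (isOpen_basic _).isClosed_compl
  · intro p hp
    refine mem_closure_iff.2 fun O hO hpO => ?_
    obtain ⟨b, hb, hbO⟩ := isOpen_iff.1 hO p hpO
    have hne : b ⊓ a ≠ ⊥ := fun h =>
      hp (p.mem_of_le _ _ (le_compl_iff_disjoint_right.2 (disjoint_iff.2 h)) hb)
    obtain ⟨q, hq⟩ := basic_nonempty_iff.2 hne
    rw [basic_inf] at hq
    exact ⟨q, hbO hq.1, hq.2⟩

theorem le_of_basic_subset_closure {a b : A.carrier} (h : basic a ⊆ closure (basic b)) :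
    a ≤ b := by
  by_contra hab
  have hne : a ⊓ bᶜ ≠ ⊥ := fun h0 =>
    hab (by simpa using le_compl_iff_disjoint_right.2 (disjoint_iff.2 h0))
  obtain ⟨p, hp⟩ := basic_nonempty_iff.2 hne
  rw [basic_inf] at hp
  have := h hp.1
  rw [closure_basic] at this
  exact this hp.2

theorem closure_basic_subset_iff {a b : A.carrier} :
    closure (basic a) ⊆ basic b ↔ NonTang A.contact a b := by
  rw [closure_basic]
  constructor
  · intro h hab
    obtain ⟨p, hpa, hpb⟩ := exists_of_contact hab
    rw [compl_compl] at hpb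
    exact hpb (h hpa)
  · intro h p hp
    exact (p.compl_mem_or_mem h).resolve_left hp

/-- The elements whose basic sets belong to 𝓕 form a proper filter, not necessarily an ultrafilter;
extend it to u. A bounded c with a ≪ c lies in u, so u determines a point, and 𝓕 converges to it: if
d ≪ b with d in u, every point contains d* or b, and the first alternative cannot hold 𝓕-almost
everywhere. -/
theorem isCompact_closure_basic {a : A.carrier} (ha : a ∈ A.bounded) :
    IsCompact (closure (basic a)) := by
  refine isCompact_iff_ultrafilter_le_nhds.2 fun 𝓕 h𝓕 => ?_
  rw [Filter.le_principal_iff] at h𝓕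
  have hF : Order.IsPFilter {b : A.carrier | basic b ∈ 𝓕} :=
    Order.IsPFilter.of_def
      ⟨⊤, Filter.mem_of_superset Filter.univ_mem fun p _ => p.top_mem⟩
      (fun b hb c hc => ⟨b ⊓ c, by
        rw [mem_ofPred_eq, basic_inf]
        exact Filter.inter_mem hb hc, inf_le_left, inf_le_right⟩)
      (fun hbc hb => Filter.mem_of_superset hb (basic_mono hbc))
  have hF0 : ⊥ ∉ hF.toPFilter := fun h => by
    obtain ⟨p, hp⟩ := 𝓕.nonempty_of_mem h
    exact p.bot_notMem hp
  obtain ⟨u, hu, hFu⟩ := exists_isUltrafilter_superset _ hF0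
  obtain ⟨c, hc, hac, -⟩ := A.isLCA.BC1 a ⊤ ha (NonTang.top A.isLCA.toIsContact)
  have hcu : c ∈ u := hFu (Filter.mem_of_superset h𝓕 (closure_basic_subset_iff.2 hac))
  have hle : (𝓕 : Filter A.Point) ≤ nhds (ofUltrafilter u ⟨hu, c, hcu, hc⟩) := by
    intro S hS
    obtain ⟨O, hOS, hO, hpO⟩ := mem_nhds_iff.1 hS
    obtain ⟨b, ⟨d, hd, -, hdb⟩, hbO⟩ := isOpen_iff.1 hO _ hpO
    have h1 : basic dᶜ ∪ basic b ∈ 𝓕 :=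
      Filter.mem_of_superset Filter.univ_mem fun p _ => p.compl_mem_or_mem hdb
    rcases Ultrafilter.union_mem_iff.1 h1 with h2 | h2
    · exact (hu.compl_notMem hd (hFu h2)).elim
    · exact Filter.mem_of_superset h2 (hbO.trans hOS)
  exact ⟨_, isClosed_closure.mem_of_frequently_of_tendsto
    (Filter.Eventually.frequently (f := (𝓕 : Filter A.Point)) h𝓕) hle, hle⟩

theorem isCompact_closure_basic_iff {a : A.carrier} :
    IsCompact (closure (basic a)) ↔ a ∈ A.bounded := by
  refine ⟨fun h => ?_, isCompact_closure_basic⟩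
  have : Nonempty A.bounded := ⟨⟨⊥, A.isLCA.BB1⟩⟩
  obtain ⟨b, hb⟩ := h.elim_directed_cover (fun b : A.bounded => basic (b : A.carrier))
    (fun b => isOpen_basic _)
    (fun p _ => by
      obtain ⟨b, hbp, hb, -⟩ := p.round _ p.top_mem
      exact mem_iUnion.2 ⟨⟨b, hb⟩, hbp⟩)
    (fun b c => ⟨⟨b ⊔ c, A.isLCA.BB3 _ _ b.2 c.2⟩, basic_mono le_sup_left,
      basic_mono le_sup_right⟩)
  exact A.isLCA.BB2 _ _ (le_of_basic_subset_closure
    ((subset_closure.trans hb).trans subset_closure)) b.2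

instance : T2Space A.Point := by
  have key : ∀ p q : A.Point, ∀ a ∈ p.carrier, a ∉ q.carrier →
      ∃ b, b ∈ p.carrier ∧ bᶜ ∈ q.carrier := by
    intro p q a ha ha'
    obtain ⟨b, hbp, -, hba⟩ := p.round a ha
    exact ⟨b, hbp, (q.compl_mem_or_mem hba).resolve_right ha'⟩
  have hd : ∀ b : A.carrier, Disjoint (basic b) (basic bᶜ) := fun b =>
    disjoint_left.2 fun p hp => p.compl_notMem hp
  refine ⟨fun p q hpq => ?_⟩
  by_cases h : p.carrier ⊆ q.carrier
  · have h' : ¬ q.carrier ⊆ p.carrier := fun h' => hpq (Point.ext (h.antisymm h'))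
    obtain ⟨a, ha, ha'⟩ := not_subset.1 h'
    obtain ⟨b, hb, hb'⟩ := key q p a ha ha'
    exact ⟨_, _, isOpen_basic _, isOpen_basic _, hb', hb, (hd b).symm⟩
  · obtain ⟨a, ha, ha'⟩ := not_subset.1 h
    obtain ⟨b, hb, hb'⟩ := key p q a ha ha'
    exact ⟨_, _, isOpen_basic _, isOpen_basic _, hb, hb', hd b⟩

instance : LocallyCompactSpace A.Point := by
  refine ⟨fun p S hS => ?_⟩
  obtain ⟨O, hOS, hO, hpO⟩ := mem_nhds_iff.1 hS
  obtain ⟨a, ha, haO⟩ := isOpen_iff.1 hO p hpO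
  obtain ⟨b, hbp, hb, hba⟩ := p.round a ha
  exact ⟨closure (basic b), Filter.mem_of_superset ((isOpen_basic b).mem_nhds hbp) subset_closure,
    ((closure_basic_subset_iff.2 hba).trans haO).trans hOS, isCompact_closure_basic hb⟩

theorem interior_closure_basic (a : A.carrier) :
    interior (closure (basic a)) = basic a := by
  rw [closure_basic, interior_compl, closure_basic, compl_compl, compl_compl]

/-- The regular open set of points containing `a`. -/
def basicRegular (a : A.carrier) : RegularOpens A.Point := RegularOpens.intCl (basic a)

theorem toSet_basicRegular (a : A.carrier) : (basicRegular a).toSet = basic a :=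
  interior_closure_basic a

theorem basicRegular_le_iff {a b : A.carrier} : basicRegular a ≤ basicRegular b ↔ a ≤ b := by
  rw [RegularOpens.le_iff, toSet_basicRegular, toSet_basicRegular]
  exact ⟨fun h => le_of_basic_subset_closure (h.trans subset_closure), basic_mono⟩

/-- W comes from the join s of all b with `basic b` inside W. If `basic s` left cl W, some nonzero b
≤ s would have its basic set outside cl W; such b is disjoint from every joinand, hence from s by
distributivity. -/
theorem basicRegular_surjective : Function.Surjective (basicRegular (A := A)) := by
  intro W
  set S := {b : A.carrier | basic b ⊆ W.toSet} with hS
  refine ⟨sSup S, RegularOpens.ext_toSet ?_⟩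
  rw [toSet_basicRegular]
  apply subset_antisymm
  · rw [← W.interior_closure]
    refine interior_maximal ?_ (isOpen_basic _)
    by_contra hn
    obtain ⟨p, hp, hpW⟩ := not_subset.1 hn
    obtain ⟨b, hb, hbW⟩ := isOpen_iff.1
      ((isOpen_basic (sSup S)).inter isClosed_closure.isOpen_compl) p ⟨hp, hpW⟩
    have hbS : b ≤ sSup S := le_of_basic_subset_closure
      ((hbW.trans inter_subset_left).trans subset_closure)
    have h0 : b ⊓ sSup S = ⊥ := by
      rw [inf_sSup_eq, iSup₂_eq_bot]
      intro c hc
      by_contra hne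
      obtain ⟨q, hq⟩ := basic_nonempty_iff.2 hne
      rw [basic_inf] at hq
      exact (hbW hq.1).2 (subset_closure (hc hq.2))
    rw [inf_eq_left.2 hbS] at h0
    exact p.bot_notMem (h0 ▸ hb)
  · intro p hp
    obtain ⟨a, ha, haW⟩ := isOpen_iff.1 W.isOpen p hp
    exact p.mem_of_le _ _ (le_sSup haW) ha

variable (A) in
/-- A complete local contact algebra is the algebra of regular open sets of its space of points. -/
noncomputable def orderIso : A.carrier ≃o RegularOpens A.Point :=
  RelIso.ofSurjective (OrderEmbedding.ofMapLEIff basicRegular fun _ _ => basicRegular_le_iff)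
    basicRegular_surjective

theorem toSet_orderIso (a : A.carrier) : (orderIso A a).toSet = basic a := toSet_basicRegular a

end ISKAL.Point

/-- The space of points of a complete local contact algebra. -/
def ISKAL.toSSKLC (A : ISKAL.{u}) : SSKLC.{u} where
  carrier := A.Point

/-- A complete local contact algebra is isomorphic to that of its space of points. -/
noncomputable def ISKAL.isoPoints (A : ISKAL.{u}) : A ≅ A.toSSKLC.toISKAL :=
  ISKAL.isoOfOrderIso (Point.orderIso A)
    (fun a b => by
      have h := RegularOpens.nonTang_iff (U := Point.orderIso A a) (V := Point.orderIso A bᶜ)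
      rw [Point.toSet_orderIso, Point.toSet_orderIso, Point.closure_basic_subset_iff, NonTang,
        NonTang, map_compl', compl_compl, compl_compl, not_iff_not] at h
      exact h)
    (fun a => by
      rw [← Point.isCompact_closure_basic_iff (a := a), ← Point.toSet_orderIso]
      rfl)

instance : regularOpensFunctor.{u}.EssSurj where
  mem_essImage A := ⟨Opposite.op A.toSSKLC, ⟨A.isoPoints.symm⟩⟩

/-! ## Fullness of the functor of regular open sets -/

namespace ISKAL.Point

variable {A B : ISKAL.{u}}

/-- The image of a point under the map dual to a morphism of local contact algebras. -/
def comap {φ : CompleteLatticeHom A.carrier B.carrier} (hφ : IsSKALMorphism φ) (p : B.Point) :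
    A.Point where
  carrier := {a | ∃ b, NonTang A.contact b a ∧ φ b ∈ p.carrier}
  top_mem := ⟨⊤, NonTang.top A.isLCA.toIsContact, by
    rw [map_top]
    exact p.top_mem⟩
  bot_notMem := by
    rintro ⟨b, hb, hbp⟩
    rw [le_bot_iff.1 (hb.le A.isLCA.toIsContact), map_bot] at hbp
    exact p.bot_notMem hbp
  mem_of_le := by
    rintro a b hab ⟨c, hca, hc⟩
    exact ⟨c, hca.mono A.isLCA.toIsContact le_rfl hab, hc⟩
  inf_mem := by
    rintro a b ⟨c, hca, hc⟩ ⟨d, hdb, hd⟩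
    refine ⟨c ⊓ d, (hca.mono A.isLCA.toIsContact inf_le_left le_rfl).inf A.isLCA.toIsContact
      (hdb.mono A.isLCA.toIsContact inf_le_right le_rfl), ?_⟩
    rw [map_inf]
    exact p.inf_mem _ _ hc hd
  round := by
    rintro a ⟨b, hba, hb⟩
    obtain ⟨v, hvp, hv, hvb⟩ := p.round _ hb
    -- Here b may be unbounded, so (BC1) is applied instead to φ_Λ v ≤ b, which is bounded by (L2).
    have h1 : NonTang A.contact (lowerAdj φ v) a :=
      hba.mono A.isLCA.toIsContact ((lowerAdj_gc φ).l_le (hvb.le B.isLCA.toIsContact)) le_rfl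
    obtain ⟨c, hc, h2, h3⟩ := A.isLCA.BC1 _ _ (hφ.L2 v hv) h1
    exact ⟨c, ⟨_, h2, p.mem_of_le _ _ ((lowerAdj_gc φ).le_u_l v) hvp⟩, hc, h3⟩
  prime a b ha hab := by
    -- In a ≪ c ≪ d ≪ b the middle inclusion is carried to B by (L1); the outer two turn membership
    -- of (φ c)* or φ d in p into membership of a* or b in the image point.
    obtain ⟨c, hc, hac, hcb⟩ := A.isLCA.BC1 _ _ ha hab
    obtain ⟨d, -, hcd, hdb⟩ := A.isLCA.BC1 _ _ hc hcb
    have h1 : NonTang B.contact (φ c) (φ d) := fun h => hcd (hφ.L1 _ _ (by rwa [map_compl']))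
    refine (p.compl_mem_or_mem h1).symm.imp (fun h => ?_) (fun h => ?_) |>.symm
    · exact ⟨d, hdb, h⟩
    · refine ⟨cᶜ, hac.compl A.isLCA.toIsContact, ?_⟩
      rwa [map_compl']

end ISKAL.Point

/-- The regular open neighbourhoods of a point of a space. -/
def ISKAL.Point.ofSpace (X : SSKLC.{u}) (x : X.carrier) : X.toISKAL.Point where
  carrier := {U | x ∈ U.toSet}
  top_mem := mem_univ x
  bot_notMem := notMem_empty x
  mem_of_le _ _ h hx := h hx
  inf_mem _ _ h₁ h₂ := ⟨h₁, h₂⟩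
  round U hU := by
    obtain ⟨V, hV, hxV, hVU⟩ := RegularOpens.exists_mem_closure_subset U.isOpen hU
    exact ⟨V, hxV, hV, RegularOpens.nonTang_iff.2 hVU⟩
  prime U V _ hUV := by
    by_cases hx : x ∈ closure U.toSet
    · exact Or.inr (RegularOpens.nonTang_iff.1 hUV hx)
    · refine Or.inl (?_ : x ∈ Uᶜ.toSet)
      rwa [RegularOpens.toSet_compl]

/-- Take x to be a limit of an ultrafilter extending p. Roundness puts x inside every member of p,
and primality puts every regular open neighbourhood of x into p. -/
theorem ISKAL.Point.exists_eq_ofSpace {X : SSKLC.{u}} (p : X.toISKAL.Point) :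
    ∃ x, ∀ U : RegularOpens X.carrier, x ∈ U.toSet ↔ U ∈ p.carrier := by
  obtain ⟨u, hu, hpu⟩ := exists_isUltrafilter_superset p.isPFilter.toPFilter p.bot_notMem
  obtain ⟨W, hWp, hW, -⟩ := p.round _ p.top_mem
  obtain ⟨x, hx⟩ := RegularOpens.exists_forall_mem_closure hu ⟨W, hpu hWp, hW⟩
  refine ⟨x, fun U => ⟨fun hxU => ?_, fun hU => ?_⟩⟩
  · obtain ⟨V, hV, hxV, hVU⟩ := RegularOpens.exists_mem_closure_subset U.isOpen hxU
    refine (p.prime V U hV (RegularOpens.nonTang_iff.2 hVU)).resolve_left fun h => ?_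
    have := hx _ (hpu h)
    rw [RegularOpens.closure_toSet_compl] at this
    exact this hxV
  · obtain ⟨V, hVp, -, hVU⟩ := p.round U hU
    exact RegularOpens.nonTang_iff.1 hVU (hx V (hpu hVp))

theorem completeLatticeHom_map_compl {A B : Type*} [CompleteBooleanAlgebra A]
    [CompleteBooleanAlgebra B] (φ : CompleteLatticeHom A B) (a : A) : φ aᶜ = (φ a)ᶜ :=
  map_compl' φ a

section Full

variable {X Y : SSKLC.{u}}
  {φ : CompleteLatticeHom (RegularOpens Y.carrier) (RegularOpens X.carrier)}
  {f : X.carrier → Y.carrier}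

/-- The neighbourhood filter of x is transported along φ to a point of the algebra of Y, which comes
from a point f x of Y. This description is all that is used about f afterwards. -/
theorem exists_map_of_isSKALMorphism
    (hφ : IsSKALMorphism (A := Y.toISKAL) (B := X.toISKAL) φ) :
    ∃ f : X.carrier → Y.carrier, ∀ x (V : RegularOpens Y.carrier), f x ∈ V.toSet ↔
      ∃ W : RegularOpens Y.carrier, closure W.toSet ⊆ V.toSet ∧ x ∈ (φ W).toSet := by
  choose f hf using fun x =>
    ((ISKAL.Point.ofSpace X x).comap (A := Y.toISKAL) hφ).exists_eq_ofSpace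
  refine ⟨f, fun x V => (hf x V).trans (exists_congr fun W => and_congr_left fun _ => ?_)⟩
  exact RegularOpens.nonTang_iff

theorem continuous_of_mem_iff
    (hf : ∀ x (V : RegularOpens Y.carrier), f x ∈ V.toSet ↔
      ∃ W : RegularOpens Y.carrier, closure W.toSet ⊆ V.toSet ∧ x ∈ (φ W).toSet) :
    Continuous f := by
  refine continuous_iff_continuousAt.2 fun x S hS => ?_
  obtain ⟨O, hOS, hO, hxO⟩ := mem_nhds_iff.1 hS
  obtain ⟨V, -, hxV, hVO⟩ := RegularOpens.exists_mem_closure_subset hO hxO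
  obtain ⟨W, hWV, hxW⟩ := (hf x V).1 hxV
  refine Filter.mem_map.2 (Filter.mem_of_superset ((φ W).isOpen.mem_nhds hxW) fun z hz => ?_)
  exact hOS (hVO (subset_closure ((hf z V).2 ⟨W, hWV, hz⟩)))

/-- For nonempty W with closure in O, the nonempty open set φ_Λ W lies in cl f(O). Otherwise some V
around a point of φ_Λ W has φ V disjoint from W, so W ≤ φ(V*) and φ_Λ W ≤ V*, a contradiction. -/
theorem isSkeletal_of_mem_iff
    (hf : ∀ x (V : RegularOpens Y.carrier), f x ∈ V.toSet ↔
      ∃ W : RegularOpens Y.carrier, closure W.toSet ⊆ V.toSet ∧ x ∈ (φ W).toSet) :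
    IsSkeletal f := by
  intro O hO ⟨x, hx⟩
  obtain ⟨W, -, hxW, hWO⟩ := RegularOpens.exists_mem_closure_subset hO hx
  have hne : lowerAdj φ W ≠ ⊥ := fun h => by
    have h1 := (lowerAdj_gc φ W ⊥).1 h.le
    rw [map_bot] at h1
    exact h1 hxW
  refine (RegularOpens.nonempty_iff.2 hne).mono
    (interior_maximal (fun y hy => ?_) (RegularOpens.isOpen _))
  refine closure_mono (image_mono (subset_closure.trans hWO)) ?_
  by_contra hy'
  obtain ⟨U, -, hyU, hU⟩ := RegularOpens.exists_mem_closure_subset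
    isClosed_closure.isOpen_compl hy'
  obtain ⟨V, -, hyV, hVU⟩ := RegularOpens.exists_mem_closure_subset U.isOpen hyU
  have h1 : ¬ W ≤ φ Vᶜ := fun h => by
    have h2 := (lowerAdj_gc φ W _).2 h hy
    change y ∈ Vᶜ.toSet at h2
    rw [RegularOpens.toSet_compl] at h2
    exact h2 (subset_closure hyV)
  apply h1
  rw [completeLatticeHom_map_compl, le_compl_iff_disjoint_right, disjoint_iff]
  by_contra h0
  obtain ⟨z, hzW, hzV⟩ := RegularOpens.nonempty_iff.2 h0
  exact hU (subset_closure ((hf z U).2 ⟨V, hVU, hzV⟩)) (subset_closure ⟨z, hzW, rfl⟩)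

/-- Let u refine the neighbourhoods of y, let v be given by (IS), and let x be a limit of v. If f x
≠ y, there are V ≪ U near f x with φ V in v and U* in u; but φ_Λ(φ V) ≤ V is not in contact with U*.
-/
theorem surjective_of_mem_iff
    (hf : ∀ x (V : RegularOpens Y.carrier), f x ∈ V.toSet ↔
      ∃ W : RegularOpens Y.carrier, closure W.toSet ⊆ V.toSet ∧ x ∈ (φ W).toSet)
    (hφ : IsISKALMorphism (A := Y.toISKAL) (B := X.toISKAL) φ) : Function.Surjective f := by
  intro y
  obtain ⟨u, hu, hub, hyu⟩ := RegularOpens.exists_isUltrafilter_of_point y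
  obtain ⟨v, hv, hvu⟩ := hφ.IS u ⟨hu, hub⟩
  obtain ⟨x, hx⟩ := RegularOpens.exists_forall_mem_closure hv.1 hv.2
  refine ⟨x, ?_⟩
  by_contra hne
  obtain ⟨O, O', hO, hO', hxO, hyO', hd⟩ := t2_separation hne
  obtain ⟨U, -, hxU, hU⟩ := RegularOpens.exists_mem_closure_subset hO hxO
  obtain ⟨V, hVU, hxV⟩ := (hf x U).1 hxU
  have hVv : φ V ∈ v := by
    refine hv.1.mem_of_compl_notMem fun h => ?_
    have := hx _ h
    rw [RegularOpens.closure_toSet_compl] at this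
    exact this hxV
  have hUu : Uᶜ ∈ u := by
    apply hyu
    rw [RegularOpens.toSet_compl]
    exact fun h => disjoint_left.1 hd (hU h) hyO'
  obtain ⟨z, hzV, hzU⟩ := hvu _ ⟨_, hVv, rfl⟩ _ hUu
  rw [RegularOpens.closure_toSet_compl] at hzU
  exact hzU (hVU (closure_mono ((lowerAdj_gc φ).l_u_le V) hzV))

/-- By the description of f, f⁻¹(U) is the union of the φ W with cl W ⊆ U. Regularity makes U the
join of these W, and φ preserves joins. -/
theorem comap_eq_of_mem_iff
    (hf : ∀ x (V : RegularOpens Y.carrier), f x ∈ V.toSet ↔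
      ∃ W : RegularOpens Y.carrier, closure W.toSet ⊆ V.toSet ∧ x ∈ (φ W).toSet) :
    RegularOpens.comap (isSkeletal_of_mem_iff hf) (continuous_of_mem_iff hf) = φ := by
  refine DFunLike.ext _ _ fun U => le_antisymm ?_ ?_
  · refine RegularOpens.intCl_le fun x hx => subset_closure ?_
    obtain ⟨W, hWU, hxW⟩ := (hf x U).1 hx
    have : W ≤ U := subset_closure.trans hWU
    exact RegularOpens.le_iff.1 (OrderHomClass.mono φ this) hxW
  · have hU : U = sSup {V | closure V.toSet ⊆ U.toSet} := by
      refine le_antisymm (fun y hy => ?_) (sSup_le fun V hV => subset_closure.trans hV)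
      obtain ⟨V, -, hyV, hVU⟩ := RegularOpens.exists_mem_closure_subset U.isOpen hy
      exact RegularOpens.le_iff.1 (le_sSup hVU) hyV
    conv_lhs => rw [hU, map_sSup]
    apply sSup_le
    rintro _ ⟨V, hV, rfl⟩ x hx
    exact RegularOpens.preimage_subset_comap _ _ U ((hf x U).2 ⟨V, hV, hx⟩)

end Full

instance : regularOpensFunctor.{u}.Full where
  map_surjective {X Y} φ := by
    obtain ⟨f, hf⟩ := exists_map_of_isSKALMorphism (X := Y.unop) (Y := X.unop)
      φ.isMorphism.toIsSKALMorphism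
    exact ⟨Quiver.Hom.op (X := Y.unop) (Y := X.unop) ⟨f, continuous_of_mem_iff hf,
      isSkeletal_of_mem_iff hf, surjective_of_mem_iff hf φ.isMorphism⟩,
      ISKAL.Hom.ext (comap_eq_of_mem_iff hf)⟩

instance : regularOpensFunctor.{u}.IsEquivalence where

end LCDuality

open CategoryTheory LCDuality

theorem mainTheorem9 :
    (∃ (K : ISKAL.{u} ⥤ IISKAL.{u}) (Θ : IISKAL.{u} ⥤ ISKAL.{u}),
      K ⋙ Θ = 𝟭 ISKAL.{u} ∧ Θ ⋙ K = 𝟭 IISKAL.{u}) ∧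
    Nonempty (SSKLC.{u}ᵒᵖ ≌ IISKAL.{u}) :=
  ⟨⟨iskalToIISKAL, iiskalToISKAL, iskalToIISKAL_comp_iiskalToISKAL,
    iiskalToISKAL_comp_iskalToIISKAL⟩,
    ⟨regularOpensFunctor.asEquivalence.trans iskalEquivIISKAL⟩⟩
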